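/- Let $N\ge 1$ and let $\Omega\subset\mathbb R^N$ be a bounded open set. Let $A\in L^\infty(\Omega)^{N\times N}$ be a (not necessarily symmetric) matrix field such that, for some $\alpha>0$, $A(x)\xi\cdot\xi\ge\alpha|\xi|^2$ for a.e. $x\in\Omega$ and all $\xi\in\mathbb R^N$. Let $\lambda_1$ be the first (smallest) eigenvalue of the operator $-\operatorname{div}\,{}^sA(x)D$ in $H^1_0(\Omega)$, where ${}^sA=(A+{}^tA)/2$ (with $\lambda_1=+\infty$ if $\Omega=\emptyset$). Let $F_1,F_2:\Omega\times[0,+\infty[\,\to[0,+\infty]$ be such that, for $i=1,2$: (a) $F_i$ is a Carathéodory function: $s\mapsto F_i(x,s)\in[0,+\infty]$ is continuous on $[0,+\infty[$ for a.e. $x\in\Omega$, and $x\mapsto F_i(x,s)$ is measurable for every $s\ge0$; (b) there exist $\gamma_i$ with $0<\gamma_i\le1$ and $h_i\in L^{r}(\Omega)$, $h_i\ge0$ a.e. in $\Omega$, such that $$0\le F_i(x,s)\le h_i(x)\Big(\frac1{s^{\gamma_i}}+1\Big)\quad\text{for a.e. }x\in\Omega,\ \forall s>0,$$ where $r=\frac{2N}{N+2}$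 if $N\ge3$, $r>1$ is some real number (which may depend on $i$) if $N=2$, and $r=1$ if $N=1$. Assume that at least one $F\in\{F_1,F_2\}$ is almost nonincreasing, i.e. there exists $\lambda$ with $0\le\lambda<\lambda_1$ such that $$F(x,s)-\lambda s\le F(x,t)-\lambda t\quad\text{for a.e. }x\in\Omega,\ \forall s,t\text{ with }0\le t\le s,$$ and that $F_1(x,s)\le F_2(x,s)$ for a.e. $x\in\Omega$ and all $s\ge0$. For $i=1,2$ let $u_i$ be a solution of $-\operatorname{div}A(x)Du_i=F_i(x,u_i)$ in $\Omega$, $u_i=0$ on $\partial\Omega$, in the following sense: $u_i\in H^1_0(\Omega)$, $u_i\ge0$ a.e. in $\Omega$, and for every $\varphi\in H^1_0(\Omega)$ with $\varphi\ge0$, $$\int_\Omega F_i(x,u_i)\varphi<+\infty\quad\text{and}\quad\int_\Omega A(x)Du_i\cdot D\varphi=\int_\Omega F_i(x,u_i)\varphi.$$ Then $u_1(x)\le u_2(x)$ for a.e. $x\in\Omega$. -/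

import Mathlib

open MeasureTheory Filter Topology TopologicalSpace
open scoped ENNReal Distributions Matrix

noncomputable section

/-- `G` is the weak (distributional) gradient of `u` on the open set `Ω`. -/
structure HasWeakGradient {N : ℕ} (Ω : Opens (EuclideanSpace ℝ (Fin N)))
    (u : EuclideanSpace ℝ (Fin N) → ℝ)
    (G : EuclideanSpace ℝ (Fin N) → EuclideanSpace ℝ (Fin N)) : Prop where
  locallyIntegrable : LocallyIntegrableOn u (Ω : Set (EuclideanSpace ℝ (Fin N)))
  locallyIntegrable_grad : LocallyIntegrableOn G (Ω : Set (EuclideanSpace ℝ (Fin N)))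
  integral_eq : ∀ φ : 𝓓(Ω, ℝ),
    ∫ x in (Ω : Set (EuclideanSpace ℝ (Fin N))), u x • gradient φ x =
      -∫ x in (Ω : Set (EuclideanSpace ℝ (Fin N))), φ x • G x

/-- `u` belongs to `H¹(Ω)`, and `Du` is its weak gradient. -/
structure MemH1 {N : ℕ} (Ω : Opens (EuclideanSpace ℝ (Fin N)))
    (u : EuclideanSpace ℝ (Fin N) → ℝ)
    (Du : EuclideanSpace ℝ (Fin N) → EuclideanSpace ℝ (Fin N)) : Prop where
  memLp : MemLp u 2 (volume.restrict (Ω : Set (EuclideanSpace ℝ (Fin N))))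
  memLp_grad : MemLp Du 2 (volume.restrict (Ω : Set (EuclideanSpace ℝ (Fin N))))
  hasWeakGradient : HasWeakGradient Ω u Du

/-- `u` belongs to `H¹₀(Ω)`, the closure of the space of test functions on `Ω` in `H¹(Ω)`,
and `Du` is its weak gradient. -/
structure MemH10 {N : ℕ} (Ω : Opens (EuclideanSpace ℝ (Fin N)))
    (u : EuclideanSpace ℝ (Fin N) → ℝ)
    (Du : EuclideanSpace ℝ (Fin N) → EuclideanSpace ℝ (Fin N)) : Prop extends MemH1 Ω u Du where
  exists_approx : ∃ φ : ℕ → 𝓓(Ω, ℝ),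
    Tendsto (fun n => eLpNorm (fun x => φ n x - u x) 2
      (volume.restrict (Ω : Set (EuclideanSpace ℝ (Fin N))))) atTop (𝓝 0) ∧
    Tendsto (fun n => eLpNorm (fun x => gradient (φ n) x - Du x) 2
      (volume.restrict (Ω : Set (EuclideanSpace ℝ (Fin N))))) atTop (𝓝 0)

/-- The form `∫_Ω A(x) Du · Dv` written in terms of the gradients of `u` and `v`. -/
def dirichletForm {N : ℕ} (Ω : Opens (EuclideanSpace ℝ (Fin N)))
    (A : EuclideanSpace ℝ (Fin N) → Matrix (Fin N) (Fin N) ℝ)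
    (Du Dv : EuclideanSpace ℝ (Fin N) → EuclideanSpace ℝ (Fin N)) : ℝ :=
  ∫ x in (Ω : Set (EuclideanSpace ℝ (Fin N))),
    inner ℝ (Matrix.toEuclideanLin (A x) (Du x)) (Dv x)

/-- `A ∈ L^∞(Ω)^{N×N}` and `A(x) ≥ α I` for almost every `x ∈ Ω`, for some `α > 0`
(the matrix `A(x)` need not be symmetric). -/
structure IsBoundedCoercive {N : ℕ} (Ω : Opens (EuclideanSpace ℝ (Fin N)))
    (A : EuclideanSpace ℝ (Fin N) → Matrix (Fin N) (Fin N) ℝ) : Prop where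
  memLp_top : ∀ i j, MemLp (fun x => A x i j) ∞
    (volume.restrict (Ω : Set (EuclideanSpace ℝ (Fin N))))
  coercive : ∃ α : ℝ, 0 < α ∧
    ∀ᵐ x ∂(volume.restrict (Ω : Set (EuclideanSpace ℝ (Fin N)))),
      ∀ ξ : EuclideanSpace ℝ (Fin N),
        α * ‖ξ‖ ^ 2 ≤ inner ℝ (Matrix.toEuclideanLin (A x) ξ) ξ

/-- `F : Ω × [0,∞[ → [0,∞]` is a Carathéodory function. The values of `F x s` for `x ∉ Ω` or
`s < 0` are never used. -/
structure IsCaratheodory {N : ℕ} (Ω : Opens (EuclideanSpace ℝ (Fin N)))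
    (F : EuclideanSpace ℝ (Fin N) → ℝ → ℝ≥0∞) : Prop where
  continuousOn : ∀ᵐ x ∂(volume.restrict (Ω : Set (EuclideanSpace ℝ (Fin N)))),
    ContinuousOn (F x) (Set.Ici 0)
  measurable : ∀ s : ℝ, 0 ≤ s →
    AEMeasurable (fun x => F x s) (volume.restrict (Ω : Set (EuclideanSpace ℝ (Fin N))))

/-- `h ∈ L^r(Ω)` with `r = 2N/(N+2)` if `N ≥ 3`, some `r > 1` if `N = 2`, and `r = 1` if
`N = 1`. -/
def MemSourceSpace {N : ℕ} (Ω : Opens (EuclideanSpace ℝ (Fin N)))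
    (h : EuclideanSpace ℝ (Fin N) → ℝ) : Prop :=
  (3 ≤ N → MemLp h (ENNReal.ofReal (2 * (N : ℝ) / ((N : ℝ) + 2)))
    (volume.restrict (Ω : Set (EuclideanSpace ℝ (Fin N))))) ∧
  (N = 2 → ∃ r : ℝ, 1 < r ∧
    MemLp h (ENNReal.ofReal r) (volume.restrict (Ω : Set (EuclideanSpace ℝ (Fin N))))) ∧
  (N = 1 → MemLp h 1 (volume.restrict (Ω : Set (EuclideanSpace ℝ (Fin N)))))

/-- `0 ≤ F(x,s) ≤ h(x) (1/s^γ + 1)` for almost every `x ∈ Ω` and all `s > 0`, for some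
`0 < γ ≤ 1` and some nonnegative `h` in the appropriate Lebesgue space. -/
def HasMildSingularity {N : ℕ} (Ω : Opens (EuclideanSpace ℝ (Fin N)))
    (F : EuclideanSpace ℝ (Fin N) → ℝ → ℝ≥0∞) : Prop :=
  ∃ (γ : ℝ) (h : EuclideanSpace ℝ (Fin N) → ℝ), 0 < γ ∧ γ ≤ 1 ∧
    MemSourceSpace Ω h ∧
    (∀ᵐ x ∂(volume.restrict (Ω : Set (EuclideanSpace ℝ (Fin N)))), 0 ≤ h x) ∧
    ∀ᵐ x ∂(volume.restrict (Ω : Set (EuclideanSpace ℝ (Fin N)))), ∀ s : ℝ, 0 < s →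
      F x s ≤ ENNReal.ofReal (h x * (1 / s ^ γ + 1))

/-- The symmetrized part `(A + ᵗA) / 2` of the matrix field `A`. -/
def symmetrized {N : ℕ} (A : EuclideanSpace ℝ (Fin N) → Matrix (Fin N) (Fin N) ℝ) :
    EuclideanSpace ℝ (Fin N) → Matrix (Fin N) (Fin N) ℝ :=
  fun x => (1 / 2 : ℝ) • (A x + (A x)ᵀ)

/-- `μ` is an eigenvalue of the operator `-div B(x) D` in `H¹₀(Ω)`, i.e. there is a nonzero
`w ∈ H¹₀(Ω)` with `-div B(x) Dw = μ w` in the weak sense. -/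
def IsDirichletEigenvalue {N : ℕ} (Ω : Opens (EuclideanSpace ℝ (Fin N)))
    (B : EuclideanSpace ℝ (Fin N) → Matrix (Fin N) (Fin N) ℝ) (μ : ℝ) : Prop :=
  ∃ (w : EuclideanSpace ℝ (Fin N) → ℝ)
    (Dw : EuclideanSpace ℝ (Fin N) → EuclideanSpace ℝ (Fin N)),
    MemH10 Ω w Dw ∧
    ¬ w =ᵐ[volume.restrict (Ω : Set (EuclideanSpace ℝ (Fin N)))] 0 ∧
    ∀ (φ : EuclideanSpace ℝ (Fin N) → ℝ)
      (Dφ : EuclideanSpace ℝ (Fin N) → EuclideanSpace ℝ (Fin N)), MemH10 Ω φ Dφ →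
      dirichletForm Ω B Dw Dφ =
        μ * ∫ x in (Ω : Set (EuclideanSpace ℝ (Fin N))), w x * φ x

/-- The first (smallest) eigenvalue `λ₁` of the operator `-div ˢA(x) D` in `H¹₀(Ω)`, where `ˢA` is
the symmetrized part of `A`. It is `+∞` when there is no eigenvalue, which happens for
`Ω = ∅`. -/
def firstEigenvalue {N : ℕ} (Ω : Opens (EuclideanSpace ℝ (Fin N)))
    (A : EuclideanSpace ℝ (Fin N) → Matrix (Fin N) (Fin N) ℝ) : EReal :=
  sInf ((fun μ : ℝ => (μ : EReal)) '' {μ : ℝ | IsDirichletEigenvalue Ω (symmetrized A) μ})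

/-- `F` is almost nonincreasing: `s ↦ F(x,s) - lam s` is nonincreasing on `[0,∞[`, for some
`0 ≤ lam < λ₁`. -/
def IsAlmostNonincreasing {N : ℕ} (Ω : Opens (EuclideanSpace ℝ (Fin N)))
    (A : EuclideanSpace ℝ (Fin N) → Matrix (Fin N) (Fin N) ℝ)
    (F : EuclideanSpace ℝ (Fin N) → ℝ → ℝ≥0∞) : Prop :=
  ∃ lam : ℝ, 0 ≤ lam ∧ (lam : EReal) < firstEigenvalue Ω A ∧
    ∀ᵐ x ∂(volume.restrict (Ω : Set (EuclideanSpace ℝ (Fin N)))),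
      ∀ s t : ℝ, 0 ≤ t → t ≤ s →
        (F x s : EReal) - ((lam * s : ℝ) : EReal) ≤ (F x t : EReal) - ((lam * t : ℝ) : EReal)

/-- `u` is a solution to the problem `-div A(x) Du = F(x,u)` in `Ω`, `u = 0` on `∂Ω`:
`u ∈ H¹₀(Ω)`, `u ≥ 0` a.e. in `Ω`, and for every `φ ∈ H¹₀(Ω)` with `φ ≥ 0` one has
`∫_Ω F(x,u) φ < +∞` and `∫_Ω A(x) Du · Dφ = ∫_Ω F(x,u) φ`. -/
def IsSolution {N : ℕ} (Ω : Opens (EuclideanSpace ℝ (Fin N)))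
    (A : EuclideanSpace ℝ (Fin N) → Matrix (Fin N) (Fin N) ℝ)
    (F : EuclideanSpace ℝ (Fin N) → ℝ → ℝ≥0∞)
    (u : EuclideanSpace ℝ (Fin N) → ℝ) : Prop :=
  ∃ Du : EuclideanSpace ℝ (Fin N) → EuclideanSpace ℝ (Fin N),
    MemH10 Ω u Du ∧
    (∀ᵐ x ∂(volume.restrict (Ω : Set (EuclideanSpace ℝ (Fin N)))), 0 ≤ u x) ∧
    ∀ (φ : EuclideanSpace ℝ (Fin N) → ℝ)
      (Dφ : EuclideanSpace ℝ (Fin N) → EuclideanSpace ℝ (Fin N)), MemH10 Ω φ Dφ →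
      (∀ᵐ x ∂(volume.restrict (Ω : Set (EuclideanSpace ℝ (Fin N)))), 0 ≤ φ x) →
      (∫⁻ x in (Ω : Set (EuclideanSpace ℝ (Fin N))), F x (u x) * ENNReal.ofReal (φ x)) < ∞ ∧
      dirichletForm Ω A Du Dφ =
        (∫⁻ x in (Ω : Set (EuclideanSpace ℝ (Fin N))),
          F x (u x) * ENNReal.ofReal (φ x)).toReal

end

noncomputable section

/-! Test both equations with `w = (u₁ - u₂)⁺`, which is admissible because `H¹₀(Ω)` is stable under
positive parts, and subtract. Where `u₁ > u₂`, the ordering `F₁ ≤ F₂` and the almost monotonicity of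
either function give `F₁(x,u₁) ≤ F₂(x,u₂) + lam (u₁ - u₂)`; elsewhere `w` vanishes. Since `Dw` is
`D(u₁ - u₂)` on `{u₁ > u₂}` and zero off it, `∫ A Dw · Dw ≤ lam ∫ w²`. The integrals of `Fᵢ(x,uᵢ) w`
are finite by the definition of a solution, so singular sources do not obstruct the subtraction.

If `w` were nonzero, its Rayleigh quotient, which sees only the symmetric part of `A`, would be at
most `lam < λ₁`. But the infimum of that quotient is attained at an eigenfunction, which would give
an eigenvalue `≤ lam`, a contradiction (`ae_eq_zero_of_dirichletForm_le`).

Since `λ₁` is defined as an infimum of eigenvalues, not of quotients, this existence statement is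
the substantial point. It rests on Rellich compactness (`isCompactOperator_h10Embedding`), obtained
by approximating the embedding in operator norm by averages over a fine grid, and on a direct
minimization (`exists_isMinOn_rayleigh`). The other analytic ingredient is `MemH10.posPart`. -/

variable {N : ℕ} {Ω : Opens (EuclideanSpace ℝ (Fin N))}

/-- Lebesgue measure on `Ω`. -/
abbrev domainMeasure (Ω : Opens (EuclideanSpace ℝ (Fin N))) :
    Measure (EuclideanSpace ℝ (Fin N)) :=
  volume.restrict (Ω : Set (EuclideanSpace ℝ (Fin N)))

/-! ### Calculus of test functions. -/

namespace TestFunction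

theorem differentiable (φ : 𝓓(Ω, ℝ)) : Differentiable ℝ φ :=
  φ.contDiff.differentiable (by simp)

theorem continuous_fderiv (φ : 𝓓(Ω, ℝ)) : Continuous (fderiv ℝ φ) :=
  φ.contDiff.continuous_fderiv (by simp)

theorem continuous_gradient (φ : 𝓓(Ω, ℝ)) : Continuous (gradient φ) :=
  (InnerProductSpace.toDual ℝ _).symm.continuous.comp φ.continuous_fderiv

theorem hasCompactSupport_gradient (φ : 𝓓(Ω, ℝ)) : HasCompactSupport (gradient φ) :=
  (φ.hasCompactSupport.fderiv ℝ).comp_left (map_zero (InnerProductSpace.toDual ℝ _).symm)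

theorem memLp (φ : 𝓓(Ω, ℝ)) (p : ℝ≥0∞) (μ : Measure (EuclideanSpace ℝ (Fin N)))
    [IsFiniteMeasureOnCompacts μ] : MemLp φ p μ :=
  φ.continuous.memLp_of_hasCompactSupport φ.hasCompactSupport

theorem memLp_gradient (φ : 𝓓(Ω, ℝ)) (p : ℝ≥0∞) (μ : Measure (EuclideanSpace ℝ (Fin N)))
    [IsFiniteMeasureOnCompacts μ] : MemLp (gradient φ) p μ :=
  φ.continuous_gradient.memLp_of_hasCompactSupport φ.hasCompactSupport_gradient

theorem eq_zero_of_notMem (φ : 𝓓(Ω, ℝ)) {x : EuclideanSpace ℝ (Fin N)} (hx : x ∉ Ω) :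
    φ x = 0 :=
  image_eq_zero_of_notMem_tsupport fun h => hx (φ.tsupport_subset h)

theorem gradient_eq_zero_of_notMem (φ : 𝓓(Ω, ℝ)) {x : EuclideanSpace ℝ (Fin N)} (hx : x ∉ Ω) :
    gradient φ x = 0 := by
  have h : x ∉ tsupport φ := fun h => hx (φ.tsupport_subset h)
  have : fderiv ℝ φ x = 0 :=
    image_eq_zero_of_notMem_tsupport fun h' => h (tsupport_fderiv_subset ℝ h')
  simp [gradient, this]

theorem gradient_add (φ ψ : 𝓓(Ω, ℝ)) (x : EuclideanSpace ℝ (Fin N)) :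
    gradient (φ + ψ : 𝓓(Ω, ℝ)) x = gradient φ x + gradient ψ x := by
  have : fderiv ℝ (φ + ψ : 𝓓(Ω, ℝ)) x = fderiv ℝ φ x + fderiv ℝ ψ x :=
    fderiv_add (φ.differentiable x) (ψ.differentiable x)
  rw [gradient, this, map_add]
  rfl

theorem gradient_smul (c : ℝ) (φ : 𝓓(Ω, ℝ)) (x : EuclideanSpace ℝ (Fin N)) :
    gradient (c • φ : 𝓓(Ω, ℝ)) x = c • gradient φ x := by
  have : fderiv ℝ (c • φ : 𝓓(Ω, ℝ)) x = c • fderiv ℝ φ x :=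
    fderiv_const_smul (φ.differentiable x) c
  rw [gradient, this, map_smul]
  rfl

/-- Integration by parts for test functions. -/
theorem integral_smul_gradient (φ ψ : 𝓓(Ω, ℝ)) :
    ∫ x in (Ω : Set (EuclideanSpace ℝ (Fin N))), φ x • gradient ψ x =
      -∫ x in (Ω : Set (EuclideanSpace ℝ (Fin N))), ψ x • gradient φ x := by
  have key : ∀ f g : 𝓓(Ω, ℝ), Integrable (fun x => f x • gradient g x) := fun f g =>
    (f.continuous.smul g.continuous_gradient).integrable_of_hasCompactSupport
      (f.hasCompactSupport.smul_right)
  have hset : ∀ f g : 𝓓(Ω, ℝ),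
      ∫ x in (Ω : Set (EuclideanSpace ℝ (Fin N))), f x • gradient g x =
        ∫ x, f x • gradient g x := fun f g =>
    setIntegral_eq_integral_of_forall_compl_eq_zero fun x hx => by
      simp [f.eq_zero_of_notMem hx]
  -- Extension by zero moves both integrals to the whole space, so no boundary term can appear;
  -- pairing with a fixed vector `v` then reduces the claim to scalar integration by parts in
  -- direction `v`.
  rw [hset, hset]
  refine ext_inner_left ℝ fun v => ?_
  rw [inner_neg_right, ← integral_inner (key φ ψ), ← integral_inner (key ψ φ)]
  have hi : ∀ f g : 𝓓(Ω, ℝ), ∀ x, inner ℝ v (f x • gradient g x) = f x * fderiv ℝ g x v := by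
    intro f g x
    rw [inner_smul_right, real_inner_comm, gradient, InnerProductSpace.toDual_symm_apply]
  simp_rw [hi]
  have hint : ∀ f g : 𝓓(Ω, ℝ), Integrable (fun x => f x * fderiv ℝ g x v) := fun f g => by
    simpa only [hi] using (key f g).const_inner (𝕜 := ℝ) v
  rw [integral_mul_fderiv_eq_neg_fderiv_mul_of_integrable (hint ψ φ |>.congr
    (ae_of_all _ fun x => mul_comm _ _)) (hint φ ψ) ?_ (fun x _ => φ.differentiable x)
    (fun x _ => ψ.differentiable x)]
  · simp_rw [mul_comm]
  · exact (φ.continuous.mul ψ.continuous).integrable_of_hasCompactSupport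
      (φ.hasCompactSupport.mul_right)

end TestFunction

/-! ### `H¹₀(Ω)` as a closed subspace of `L² × L²`. -/

/-- The pair `(φ, ∇φ)`, as an element of `L²(Ω) × L²(Ω)^N`. -/
def testPair (Ω : Opens (EuclideanSpace ℝ (Fin N))) :
    𝓓(Ω, ℝ) →ₗ[ℝ] Lp ℝ 2 (domainMeasure Ω) ×
      Lp (EuclideanSpace ℝ (Fin N)) 2 (domainMeasure Ω) where
  toFun φ := ((φ.memLp 2 _).toLp φ, (φ.memLp_gradient 2 _).toLp (gradient φ))
  map_add' φ ψ := by
    refine Prod.ext rfl ?_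
    exact MemLp.toLp_congr (TestFunction.memLp_gradient _ 2 _)
      ((φ.memLp_gradient 2 _).add (ψ.memLp_gradient 2 _))
      (ae_of_all _ fun x => TestFunction.gradient_add φ ψ x)
  map_smul' c φ := by
    refine Prod.ext rfl ?_
    exact MemLp.toLp_congr (TestFunction.memLp_gradient _ 2 _)
      ((φ.memLp_gradient 2 _).const_smul c)
      (ae_of_all _ fun x => TestFunction.gradient_smul c φ x)

/-- `H¹₀(Ω)` as a closed subspace of `L²(Ω) × L²(Ω)^N`. -/
def h10 (Ω : Opens (EuclideanSpace ℝ (Fin N))) :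
    Submodule ℝ (Lp ℝ 2 (domainMeasure Ω) ×
      Lp (EuclideanSpace ℝ (Fin N)) 2 (domainMeasure Ω)) :=
  (LinearMap.range (testPair Ω)).topologicalClosure

theorem tendsto_testPair_iff {u : EuclideanSpace ℝ (Fin N) → ℝ}
    {Du : EuclideanSpace ℝ (Fin N) → EuclideanSpace ℝ (Fin N)}
    (hu : MemLp u 2 (domainMeasure Ω)) (hDu : MemLp Du 2 (domainMeasure Ω))
    (φ : ℕ → 𝓓(Ω, ℝ)) :
    Tendsto (fun n => testPair Ω (φ n)) atTop (𝓝 (hu.toLp u, hDu.toLp Du)) ↔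
      Tendsto (fun n => eLpNorm (fun x => φ n x - u x) 2 (domainMeasure Ω)) atTop (𝓝 0) ∧
      Tendsto (fun n => eLpNorm (fun x => gradient (φ n) x - Du x) 2 (domainMeasure Ω))
        atTop (𝓝 0) := by
  rw [nhds_prod_eq, tendsto_prod_iff']
  exact and_congr
    (Lp.tendsto_Lp_iff_tendsto_eLpNorm'' (fun n => φ n) (fun n => (φ n).memLp 2 _) u hu)
    (Lp.tendsto_Lp_iff_tendsto_eLpNorm'' (fun n => gradient (φ n))
      (fun n => (φ n).memLp_gradient 2 _) Du hDu)

theorem tendsto_integral_smul_of_tendsto_eLpNorm {α F : Type*} [MeasurableSpace α]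
    [NormedAddCommGroup F] [NormedSpace ℝ F] {μ : Measure α} {f : ℕ → α → ℝ} {g : ℕ → α → F}
    {f₀ : α → ℝ} {g₀ : α → F} (hf : ∀ n, MemLp (f n) 2 μ) (hg : ∀ n, MemLp (g n) 2 μ)
    (hf₀ : MemLp f₀ 2 μ) (hg₀ : MemLp g₀ 2 μ)
    (hft : Tendsto (fun n => eLpNorm (fun x => f n x - f₀ x) 2 μ) atTop (𝓝 0))
    (hgt : Tendsto (fun n => eLpNorm (fun x => g n x - g₀ x) 2 μ) atTop (𝓝 0)) :
    Tendsto (fun n => ∫ x, f n x • g n x ∂μ) atTop (𝓝 (∫ x, f₀ x • g₀ x ∂μ)) := by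
  have hbd : Tendsto (fun n => eLpNorm (fun x => f n x - f₀ x) 2 μ *
      (eLpNorm (fun x => g n x - g₀ x) 2 μ + eLpNorm g₀ 2 μ) +
      eLpNorm f₀ 2 μ * eLpNorm (fun x => g n x - g₀ x) 2 μ) atTop (𝓝 0) := by
    have h1 := ENNReal.Tendsto.mul hft (Or.inr (by simpa using hg₀.2.ne))
      (hgt.add (tendsto_const_nhds (x := eLpNorm g₀ 2 μ))) (Or.inr (by simp))
    have h2 := ENNReal.Tendsto.const_mul hgt (a := eLpNorm f₀ 2 μ) (Or.inr hf₀.2.ne)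
    simpa using h1.add h2
  refine tendsto_integral_of_L1' _ ?_ (Eventually.of_forall fun n => ?_) ?_
  · exact hf₀.1.smul hg₀.1
  · exact memLp_one_iff_integrable.1 ((hg n).smul (hf n))
  refine tendsto_of_tendsto_of_tendsto_of_le_of_le tendsto_const_nhds hbd (fun _ => zero_le)
    fun n => ?_
  -- Splitting `fₙgₙ - f₀g₀ = (fₙ - f₀)gₙ + f₀(gₙ - g₀)` lets Hölder bound each term in `L¹`; the
  -- norms of `gₙ` are controlled by the triangle inequality.
  have e : (fun x => f n x • g n x) - (fun x => f₀ x • g₀ x) =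
      ((fun x => f n x - f₀ x) • (g n)) + (f₀ • (fun x => g n x - g₀ x)) := by
    ext x; simp [sub_smul, smul_sub]
  have hg' : eLpNorm (g n) 2 μ ≤ eLpNorm (fun x => g n x - g₀ x) 2 μ + eLpNorm g₀ 2 μ := by
    have := eLpNorm_add_le (((hg n).sub hg₀).1) hg₀.1 (p := 2) (by norm_num)
    rwa [sub_add_cancel] at this
  change eLpNorm ((fun x => f n x • g n x) - (fun x => f₀ x • g₀ x)) 1 μ ≤ _
  rw [e]
  refine (eLpNorm_add_le (((hf n).sub hf₀).1.smul (hg n).1)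
    (hf₀.1.smul ((hg n).sub hg₀).1) le_rfl).trans (add_le_add ?_ ?_)
  · exact (eLpNorm_smul_le_mul_eLpNorm (hg n).1 ((hf n).sub hf₀).1).trans (mul_le_mul_right hg' _)
  · exact eLpNorm_smul_le_mul_eLpNorm ((hg n).sub hg₀).1 hf₀.1

/-- The weak gradient identity comes for free: it holds for test functions and both of its sides
pass to `L²` limits. Membership in `H¹₀` thereby becomes a closed linear condition, from which
stability under differences and limits follows. -/
theorem memH10_iff {u : EuclideanSpace ℝ (Fin N) → ℝ}
    {Du : EuclideanSpace ℝ (Fin N) → EuclideanSpace ℝ (Fin N)} :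
    MemH10 Ω u Du ↔ ∃ (hu : MemLp u 2 (domainMeasure Ω)) (hDu : MemLp Du 2 (domainMeasure Ω)),
      (hu.toLp u, hDu.toLp Du) ∈ h10 Ω := by
  constructor
  · intro h
    refine ⟨h.memLp, h.memLp_grad, ?_⟩
    obtain ⟨φ, hφ⟩ := h.exists_approx
    exact mem_closure_of_tendsto ((tendsto_testPair_iff h.memLp h.memLp_grad φ).2 hφ)
      (Eventually.of_forall fun n => ⟨φ n, rfl⟩)
  · rintro ⟨hu, hDu, h⟩
    obtain ⟨s, hs, hst⟩ := mem_closure_iff_seq_limit.1 h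
    choose φ hφ using hs
    have hφt := (tendsto_testPair_iff hu hDu φ).1
      (by rwa [show (fun n => testPair Ω (φ n)) = s from funext hφ])
    refine ⟨⟨hu, hDu, ⟨?_, ?_, fun ψ => ?_⟩⟩, φ, hφt⟩
    · exact locallyIntegrableOn_of_locallyIntegrable_restrict (hu.locallyIntegrable (by norm_num))
    · exact locallyIntegrableOn_of_locallyIntegrable_restrict (hDu.locallyIntegrable (by norm_num))
    · have h1 := tendsto_integral_smul_of_tendsto_eLpNorm (fun n => (φ n).memLp 2 _)
        (fun _ => ψ.memLp_gradient 2 _) hu (ψ.memLp_gradient 2 _) hφt.1 (by simp)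
      have h2 := tendsto_integral_smul_of_tendsto_eLpNorm (fun _ => ψ.memLp 2 _)
        (fun n => (φ n).memLp_gradient 2 _) (ψ.memLp 2 _) hDu (by simp) hφt.2
      refine tendsto_nhds_unique h1 ?_
      exact h2.neg.congr fun n => (TestFunction.integral_smul_gradient (φ n) ψ).symm

theorem MemH10.sub {u v : EuclideanSpace ℝ (Fin N) → ℝ}
    {Du Dv : EuclideanSpace ℝ (Fin N) → EuclideanSpace ℝ (Fin N)}
    (hu : MemH10 Ω u Du) (hv : MemH10 Ω v Dv) : MemH10 Ω (u - v) (Du - Dv) := by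
  obtain ⟨hu, hDu, hmu⟩ := memH10_iff.1 hu
  obtain ⟨hv, hDv, hmv⟩ := memH10_iff.1 hv
  exact memH10_iff.2 ⟨hu.sub hv, hDu.sub hDv, (h10 Ω).sub_mem hmu hmv⟩

theorem memH10_of_tendsto {u : EuclideanSpace ℝ (Fin N) → ℝ}
    {Du : EuclideanSpace ℝ (Fin N) → EuclideanSpace ℝ (Fin N)}
    {v : ℕ → EuclideanSpace ℝ (Fin N) → ℝ}
    {Dv : ℕ → EuclideanSpace ℝ (Fin N) → EuclideanSpace ℝ (Fin N)}
    (hv : ∀ n, MemH10 Ω (v n) (Dv n)) (hu : MemLp u 2 (domainMeasure Ω))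
    (hDu : MemLp Du 2 (domainMeasure Ω))
    (h : Tendsto (fun n => eLpNorm (v n - u) 2 (domainMeasure Ω)) atTop (𝓝 0))
    (hD : Tendsto (fun n => eLpNorm (Dv n - Du) 2 (domainMeasure Ω)) atTop (𝓝 0)) :
    MemH10 Ω u Du := by
  refine memH10_iff.2 ⟨hu, hDu, ?_⟩
  refine (Submodule.isClosed_topologicalClosure _).mem_of_tendsto
    (f := fun n => ((hv n).memLp.toLp (v n), (hv n).memLp_grad.toLp (Dv n))) (b := atTop) ?_
    (Eventually.of_forall fun n => (memH10_iff.1 (hv n)).2.2)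
  rw [nhds_prod_eq, tendsto_prod_iff']
  exact ⟨(Lp.tendsto_Lp_iff_tendsto_eLpNorm'' v (fun n => (hv n).memLp) u hu).2 h,
    (Lp.tendsto_Lp_iff_tendsto_eLpNorm'' Dv (fun n => (hv n).memLp_grad) Du hDu).2 hD⟩

/-! ### Chain rule and positive part in `H¹₀(Ω)`. -/

theorem tendsto_eLpNorm_two_zero_of_dominated {α F : Type*} [MeasurableSpace α]
    [NormedAddCommGroup F] {μ : Measure α} {f : ℕ → α → F} {g : α → ℝ}
    (hf : ∀ n, AEStronglyMeasurable (f n) μ) (hg : MemLp g 2 μ)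
    (hfg : ∀ n, ∀ᵐ x ∂μ, ‖f n x‖ ≤ g x)
    (hlim : ∀ᵐ x ∂μ, Tendsto (fun n => f n x) atTop (𝓝 0)) :
    Tendsto (fun n => eLpNorm (f n) 2 μ) atTop (𝓝 0) := by
  have h : Tendsto (fun n => ∫⁻ x, ‖f n x‖ₑ ^ (2 : ℝ) ∂μ) atTop (𝓝 (∫⁻ _, 0 ∂μ)) := by
    refine tendsto_lintegral_of_dominated_convergence' (fun x => ‖g x‖ₑ ^ (2 : ℝ))
      (fun n => (hf n).enorm.pow_const _) (fun n => ?_) ?_ ?_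
    · filter_upwards [hfg n] with x hx
      gcongr
      exact enorm_le_iff_norm_le.2 (hx.trans (le_abs_self _))
    · have := lintegral_rpow_enorm_lt_top_of_eLpNorm_lt_top (by norm_num) (by norm_num) hg.2
      simpa using this.ne
    · filter_upwards [hlim] with x hx
      have := (ENNReal.continuous_rpow_const (y := 2)).tendsto _ |>.comp hx.enorm
      simpa [Function.comp_def] using this
  have h2 := ((ENNReal.continuous_rpow_const (y := 1 / 2)).tendsto _).comp h
  simpa [Function.comp_def, eLpNorm_eq_lintegral_rpow_enorm_toReal] using h2

theorem TestFunction.memH10 (φ : 𝓓(Ω, ℝ)) : MemH10 Ω φ (gradient φ) :=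
  memH10_iff.2 ⟨φ.memLp 2 _, φ.memLp_gradient 2 _, subset_closure ⟨φ, rfl⟩⟩

/-- Composition of a test function with a smooth function vanishing at `0`. -/
def TestFunction.compLeft (φ : 𝓓(Ω, ℝ)) {G : ℝ → ℝ} (hG : ContDiff ℝ (⊤ : ℕ∞) G) (hG0 : G 0 = 0) :
    𝓓(Ω, ℝ) :=
  ⟨G ∘ φ, hG.comp φ.contDiff, φ.hasCompactSupport.comp_left hG0,
    (closure_mono (Function.support_comp_subset hG0 φ)).trans φ.tsupport_subset⟩

theorem TestFunction.gradient_compLeft (φ : 𝓓(Ω, ℝ)) {G : ℝ → ℝ} (hG : ContDiff ℝ (⊤ : ℕ∞) G)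
    (hG0 : G 0 = 0) (x : EuclideanSpace ℝ (Fin N)) :
    gradient (φ.compLeft hG hG0) x = deriv G (φ x) • gradient φ x := by
  have h1 : HasDerivAt G (deriv G (φ x)) (φ x) :=
    (hG.differentiable (by simp) _).hasDerivAt
  have : fderiv ℝ (φ.compLeft hG hG0) x = deriv G (φ x) • fderiv ℝ φ x :=
    (h1.comp_hasFDerivAt x (φ.differentiable x).hasFDerivAt).fderiv
  rw [gradient, this, map_smul]
  rfl

/-- If test functions `φₙ` approximate `u`, then `G ∘ φₙ` are again test functions, because `G` is
smooth and vanishes at `0`. They converge to `G ∘ u` since `G` is Lipschitz. -/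
theorem MemH10.comp_smooth {u : EuclideanSpace ℝ (Fin N) → ℝ}
    {Du : EuclideanSpace ℝ (Fin N) → EuclideanSpace ℝ (Fin N)} (hu : MemH10 Ω u Du)
    {G : ℝ → ℝ} (hG : ContDiff ℝ (⊤ : ℕ∞) G) (hG0 : G 0 = 0) {C : ℝ} (hC : ∀ t, |deriv G t| ≤ C) :
    MemH10 Ω (fun x => G (u x)) (fun x => deriv G (u x) • Du x) := by
  have hG' : Continuous (deriv G) := hG.continuous_deriv (by simp)
  have hlip : ∀ s t, ‖G s - G t‖ ≤ C * ‖s - t‖ := fun s t =>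
    Convex.norm_image_sub_le_of_norm_deriv_le (s := Set.univ)
      (fun x _ => hG.differentiable (by simp) x) (fun x _ => hC x) convex_univ trivial trivial
  obtain ⟨φ, hφ, hDφ⟩ := hu.exists_approx
  -- Almost everywhere convergence is needed for `G'(φₙ) Du → G'(u) Du`, where only dominated
  -- convergence is available.
  obtain ⟨ns, hns, hae⟩ := (tendstoInMeasure_of_tendsto_eLpNorm (by norm_num)
    (fun n => (φ n).continuous.aestronglyMeasurable) hu.memLp.1 hφ).exists_seq_tendsto_ae
  replace hφ := hφ.comp hns.tendsto_atTop
  replace hDφ := hDφ.comp hns.tendsto_atTop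
  have hm1 : AEStronglyMeasurable (fun x => G (u x)) (domainMeasure Ω) :=
    hG.continuous.comp_aestronglyMeasurable hu.memLp.1
  have hm2 : AEStronglyMeasurable (fun x => deriv G (u x)) (domainMeasure Ω) :=
    hG'.comp_aestronglyMeasurable hu.memLp.1
  have hgu : MemLp (fun x => deriv G (u x) • Du x) 2 (domainMeasure Ω) := by
    refine hu.memLp_grad.of_le_mul (c := C) (hm2.smul hu.memLp_grad.1) (ae_of_all _ fun x => ?_)
    rw [norm_smul]
    gcongr
    exact hC _
  refine memH10_of_tendsto (fun n => ((φ (ns n)).compLeft hG hG0).memH10) ?_ hgu ?_ ?_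
  · refine hu.memLp.of_le_mul (c := C) hm1 (ae_of_all _ fun x => ?_)
    simpa [hG0] using hlip (u x) 0
  · refine tendsto_of_tendsto_of_tendsto_of_le_of_le tendsto_const_nhds
      (by simpa using ENNReal.Tendsto.const_mul hφ (a := ENNReal.ofReal C) (Or.inr (by simp)))
      (fun _ => zero_le) fun n => ?_
    exact eLpNorm_le_mul_eLpNorm_of_ae_le_mul (ae_of_all _ fun x => hlip _ _) _
  · have h1 : Tendsto (fun n => ENNReal.ofReal C *
        eLpNorm (fun x => gradient (φ (ns n)) x - Du x) 2 (domainMeasure Ω)) atTop (𝓝 0) := by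
      simpa using ENNReal.Tendsto.const_mul hDφ (a := ENNReal.ofReal C) (Or.inr (by simp))
    have hmn : ∀ n, AEStronglyMeasurable (fun x => deriv G (φ (ns n) x)) (domainMeasure Ω) :=
      fun n => (hG'.comp (φ (ns n)).continuous).aestronglyMeasurable
    have h2 : Tendsto (fun n => eLpNorm (fun x => (deriv G (φ (ns n) x) - deriv G (u x)) • Du x) 2
        (domainMeasure Ω)) atTop (𝓝 0) := by
      refine tendsto_eLpNorm_two_zero_of_dominated (g := fun x => (C + C) * ‖Du x‖)
        (fun n => ((hmn n).sub hm2).smul hu.memLp_grad.1) (hu.memLp_grad.norm.const_mul _)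
        (fun n => ae_of_all _ fun x => ?_) ?_
      · rw [norm_smul]
        gcongr
        exact (norm_sub_le _ _).trans (add_le_add (hC _) (hC _))
      · filter_upwards [hae] with x hx
        have := ((hG'.tendsto _).comp hx).sub (tendsto_const_nhds (x := deriv G (u x)))
        simpa using this.smul_const (Du x)
    refine tendsto_of_tendsto_of_tendsto_of_le_of_le tendsto_const_nhds
      (by simpa using h1.add h2) (fun _ => zero_le) fun n => ?_
    -- The first summand is small because `G'` is bounded, the second by dominated convergence.
    have e : gradient ((φ (ns n)).compLeft hG hG0) - (fun x => deriv G (u x) • Du x) =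
        (fun x => deriv G (φ (ns n) x) • (gradient (φ (ns n)) x - Du x)) +
          fun x => (deriv G (φ (ns n) x) - deriv G (u x)) • Du x := by
      ext1 x
      simp only [Pi.sub_apply, Pi.add_apply, TestFunction.gradient_compLeft, smul_sub, sub_smul]
      abel
    have hs := ((φ (ns n)).memLp_gradient 2 _).sub hu.memLp_grad
    rw [e]
    refine (eLpNorm_add_le ((hmn n).smul hs.1) (((hmn n).sub hm2).smul hu.memLp_grad.1)
      (by norm_num)).trans (add_le_add_left ?_ _)
    refine eLpNorm_le_mul_eLpNorm_of_ae_le_mul (ae_of_all _ fun x => ?_) _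
    change ‖deriv G (φ (ns n) x) • (gradient (φ (ns n)) x - Du x)‖ ≤ _
    rw [norm_smul]
    gcongr
    exact hC _

/-- A smooth approximation of the positive part, vanishing on `]-∞, 0]`. -/
def smoothPosPart (t : ℝ) : ℝ := t * Real.smoothTransition t

theorem contDiff_smoothPosPart : ContDiff ℝ (⊤ : ℕ∞) smoothPosPart :=
  contDiff_id.mul Real.smoothTransition.contDiff

theorem deriv_smoothPosPart_of_nonpos {t : ℝ} (ht : t ≤ 0) : deriv smoothPosPart t = 0 := by
  have hs : DifferentiableAt ℝ Real.smoothTransition t :=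
    (Real.smoothTransition.contDiff (n := 1)).differentiable (by simp) t
  have h : deriv smoothPosPart t = 1 * Real.smoothTransition t + t * deriv Real.smoothTransition t :=
    ((hasDerivAt_id t).mul hs.hasDerivAt).deriv
  rw [h, Real.smoothTransition.zero_of_nonpos ht]
  rcases ht.eq_or_lt with rfl | ht
  · simp
  · have : Real.smoothTransition =ᶠ[𝓝 t] fun _ => 0 := by
      filter_upwards [Iio_mem_nhds ht] with x hx
      exact Real.smoothTransition.zero_of_nonpos hx.le
    simp [this.deriv_eq]

theorem deriv_smoothPosPart_of_one_lt {t : ℝ} (ht : 1 < t) : deriv smoothPosPart t = 1 := by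
  have : smoothPosPart =ᶠ[𝓝 t] fun x => x := by
    filter_upwards [Ioi_mem_nhds ht] with x hx
    rw [smoothPosPart, Real.smoothTransition.one_of_one_le (le_of_lt hx), mul_one]
  simp [this.deriv_eq]

theorem exists_abs_deriv_smoothPosPart_le : ∃ C, ∀ t, |deriv smoothPosPart t| ≤ C := by
  obtain ⟨C, hC⟩ := (isCompact_Icc (a := (0 : ℝ)) (b := 1)).exists_bound_of_continuousOn
    (contDiff_smoothPosPart.continuous_deriv (by simp)).continuousOn
  refine ⟨max C 1, fun t => ?_⟩
  rcases le_or_gt t 0 with h | h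
  · simp [deriv_smoothPosPart_of_nonpos h]
  rcases le_or_gt t 1 with h' | h'
  · exact (hC t ⟨h.le, h'⟩).trans (le_max_left _ _)
  · simp [deriv_smoothPosPart_of_one_lt h']

/-- Rescaling `smoothPosPart` to `Gₙ(t) = smoothPosPart((n+1)t)/(n+1)` leaves the bound on the
derivative unchanged. As `Gₙ'` vanishes on `]-∞, 0]` and is eventually `1` at each `t > 0`, it
converges to the indicator of `{t > 0}` at every point. The limit gradient is thus identified
without knowing that `Du = 0` a.e. on `{u = 0}`. -/
theorem MemH10.posPart {u : EuclideanSpace ℝ (Fin N) → ℝ}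
    {Du : EuclideanSpace ℝ (Fin N) → EuclideanSpace ℝ (Fin N)} (hu : MemH10 Ω u Du) :
    MemH10 Ω (fun x => max (u x) 0) ({x | 0 < u x}.indicator Du) := by
  obtain ⟨C, hC⟩ := exists_abs_deriv_smoothPosPart_le
  set G : ℕ → ℝ → ℝ := fun n t => (n + 1 : ℝ)⁻¹ * smoothPosPart ((n + 1) * t) with hGdef
  have hpos : ∀ n : ℕ, (0 : ℝ) < n + 1 := fun n => by positivity
  have hG : ∀ n, ContDiff ℝ (⊤ : ℕ∞) (G n) := fun n =>
    contDiff_const.mul (contDiff_smoothPosPart.comp (contDiff_const.mul contDiff_id))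
  have hG' : ∀ n t, deriv (G n) t = deriv smoothPosPart ((n + 1) * t) := fun n t => by
    have h1 : HasDerivAt (fun t : ℝ => (n + 1 : ℝ) * t) (n + 1) t := by
      simpa using (hasDerivAt_id t).const_mul (n + 1 : ℝ)
    have h2 := ((contDiff_smoothPosPart.differentiable (by simp) _).hasDerivAt.comp t h1).const_mul
      (n + 1 : ℝ)⁻¹
    rw [show G n = fun t => (n + 1 : ℝ)⁻¹ * (smoothPosPart ∘ fun t => (n + 1 : ℝ) * t) t from rfl,
      h2.deriv]
    field_simp [(hpos n).ne']
  have hGs : ∀ n t, G n t = t * Real.smoothTransition ((n + 1) * t) := fun n t => by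
    simp only [hGdef, smoothPosPart]
    field_simp [(hpos n).ne']
  have hlarge : ∀ {t : ℝ}, 0 < t → ∀ᶠ n : ℕ in atTop, 1 < ((n : ℝ) + 1) * t := fun {t} ht => by
    have : Tendsto (fun n : ℕ => ((n : ℝ) + 1) * t) atTop atTop :=
      (tendsto_atTop_add_const_right _ _ tendsto_natCast_atTop_atTop).atTop_mul_const ht
    exact this.eventually_gt_atTop 1
  have hneg : ∀ {t : ℝ}, t ≤ 0 → ∀ n : ℕ, ((n : ℝ) + 1) * t ≤ 0 := fun ht n =>
    mul_nonpos_of_nonneg_of_nonpos (hpos n).le ht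
  have hset : NullMeasurableSet {x | 0 < u x} (domainMeasure Ω) :=
    nullMeasurableSet_lt aemeasurable_const hu.memLp.1.aemeasurable
  have hv : ∀ n, MemH10 Ω (fun x => G n (u x)) (fun x => deriv (G n) (u x) • Du x) := fun n =>
    hu.comp_smooth (hG n) (by simp [hGs]) (C := C) fun t => by rw [hG']; exact hC _
  have hP : MemLp (fun x => max (u x) 0) 2 (domainMeasure Ω) := hu.memLp.pos_part
  have hDP : MemLp ({x | 0 < u x}.indicator Du) 2 (domainMeasure Ω) := by
    refine hu.memLp_grad.of_le (hu.memLp_grad.1.indicator₀ hset) (ae_of_all _ fun x => ?_)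
    exact norm_indicator_le_norm_self _ _
  refine memH10_of_tendsto hv hP hDP ?_ ?_
  · refine tendsto_eLpNorm_two_zero_of_dominated (g := fun x => 2 * ‖u x‖)
      (fun n => (hv n).memLp.1.sub hP.1) (hu.memLp.norm.const_mul _)
      (fun n => ae_of_all _ fun x => ?_) (ae_of_all _ fun x => ?_)
    · refine (norm_sub_le _ _).trans ?_
      rw [two_mul]
      refine add_le_add ?_ ?_
      · change ‖G n (u x)‖ ≤ _
        rw [hGs, norm_mul, Real.norm_of_nonneg (Real.smoothTransition.nonneg _)]
        exact mul_le_of_le_one_right (norm_nonneg _) (Real.smoothTransition.le_one _)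
      · rw [Real.norm_of_nonneg (le_max_right _ _)]
        exact max_le (le_abs_self _) (norm_nonneg _)
    · refine tendsto_const_nhds.congr' ?_
      rcases le_or_gt (u x) 0 with h | h
      · refine Eventually.of_forall fun n => ?_
        simp [hGs, h, Real.smoothTransition.zero_of_nonpos (hneg h n)]
      · filter_upwards [hlarge h] with n hn
        simp [hGs, h.le, Real.smoothTransition.one_of_one_le hn.le]
  · refine tendsto_eLpNorm_two_zero_of_dominated (g := fun x => (C + 1) * ‖Du x‖)
      (fun n => (hv n).memLp_grad.1.sub hDP.1) (hu.memLp_grad.norm.const_mul _)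
      (fun n => ae_of_all _ fun x => ?_) (ae_of_all _ fun x => ?_)
    · refine (norm_sub_le _ _).trans ?_
      rw [add_mul, one_mul]
      refine add_le_add ?_ (norm_indicator_le_norm_self _ _)
      change ‖deriv (G n) (u x) • Du x‖ ≤ _
      rw [norm_smul, hG']
      gcongr
      exact hC _
    · refine tendsto_const_nhds.congr' ?_
      rcases le_or_gt (u x) 0 with h | h
      · refine Eventually.of_forall fun n => ?_
        simp [hG', h.not_gt, deriv_smoothPosPart_of_nonpos (hneg h n)]
      · filter_upwards [hlarge h] with n hn
        simp [hG', h, deriv_smoothPosPart_of_one_lt hn]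

/-! ### Translation estimates in `L²`. -/

theorem sq_lintegral_le {α : Type*} [MeasurableSpace α] {μ : Measure α} {f : α → ℝ≥0∞}
    (hf : AEMeasurable f μ) : (∫⁻ x, f x ∂μ) ^ 2 ≤ μ Set.univ * ∫⁻ x, f x ^ 2 ∂μ := by
  have h := ENNReal.lintegral_mul_le_Lp_mul_Lq μ Real.HolderConjugate.two_two
    (aemeasurable_const (b := (1 : ℝ≥0∞))) hf
  simp only [Pi.mul_apply, one_mul, lintegral_const, ENNReal.rpow_two, one_pow] at h
  calc _ ≤ (μ Set.univ ^ (1 / 2 : ℝ) * (∫⁻ x, f x ^ 2 ∂μ) ^ (1 / 2 : ℝ)) ^ 2 := by gcongr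
    _ = _ := by
      rw [mul_pow, ← ENNReal.rpow_natCast, ← ENNReal.rpow_natCast, ← ENNReal.rpow_mul,
        ← ENNReal.rpow_mul]
      norm_num

theorem eLpNorm_two_sq {α F : Type*} [MeasurableSpace α] [NormedAddCommGroup F] {μ : Measure α}
    (f : α → F) : eLpNorm f 2 μ ^ 2 = ∫⁻ x, ‖f x‖ₑ ^ 2 ∂μ := by
  have := eLpNorm_nnreal_pow_eq_lintegral (f := f) (p := 2) (μ := μ) (by norm_num)
  simpa using this

namespace TestFunction

theorem enorm_gradient (φ : 𝓓(Ω, ℝ)) (x : EuclideanSpace ℝ (Fin N)) :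
    ‖gradient φ x‖ₑ = ‖fderiv ℝ φ x‖ₑ := by
  rw [gradient, LinearIsometryEquiv.enorm_map]

/-- The fundamental theorem of calculus along the segment from `x` to `x + h`, followed by
Cauchy-Schwarz on the unit interval. -/
theorem sq_enorm_add_sub_le (φ : 𝓓(Ω, ℝ)) (x h : EuclideanSpace ℝ (Fin N)) :
    ‖φ (x + h) - φ x‖ₑ ^ 2 ≤
      ‖h‖ₑ ^ 2 * ∫⁻ t in Set.Ioc (0 : ℝ) 1, ‖gradient φ (x + t • h)‖ₑ ^ 2 := by
  have hc : Continuous fun t : ℝ => fderiv ℝ φ (x + t • h) h := by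
    have := φ.continuous_fderiv
    fun_prop
  have hd : ∀ t ∈ Set.uIcc (0 : ℝ) 1,
      HasDerivAt (fun t : ℝ => φ (x + t • h)) (fderiv ℝ φ (x + t • h) h) t := fun t _ => by
    have h1 : HasDerivAt (fun t : ℝ => x + t • h) h t := by
      simpa using ((hasDerivAt_id t).smul_const h).const_add x
    exact (φ.differentiable (x + t • h)).hasFDerivAt.comp_hasDerivAt t h1
  have hI := intervalIntegral.integral_eq_sub_of_hasDerivAt hd (hc.intervalIntegrable _ _)
  simp only [one_smul, zero_smul, add_zero] at hI
  have hg := φ.continuous_gradient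
  have hm : Measurable fun t : ℝ => ‖gradient φ (x + t • h)‖ₑ := by
    have : Continuous fun t : ℝ => gradient φ (x + t • h) := by fun_prop
    exact this.measurable.enorm
  have h1 : ‖φ (x + h) - φ x‖ₑ ≤ ‖h‖ₑ * ∫⁻ t in Set.Ioc (0 : ℝ) 1, ‖gradient φ (x + t • h)‖ₑ := by
    rw [← hI, intervalIntegral.integral_of_le zero_le_one, ← lintegral_const_mul _ hm]
    refine (enorm_integral_le_lintegral_enorm _).trans (lintegral_mono fun t => ?_)
    rw [enorm_gradient, mul_comm]
    exact (fderiv ℝ φ (x + t • h)).le_opENorm h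
  calc _ ≤ (‖h‖ₑ * ∫⁻ t in Set.Ioc (0 : ℝ) 1, ‖gradient φ (x + t • h)‖ₑ) ^ 2 := by gcongr
    _ ≤ _ := by
      rw [mul_pow]
      gcongr
      refine (sq_lintegral_le hm.aemeasurable).trans ?_
      simp

/-- The `L²` modulus of continuity of a test function is controlled by its gradient. -/
theorem lintegral_sq_enorm_add_sub_le (φ : 𝓓(Ω, ℝ)) (h : EuclideanSpace ℝ (Fin N)) :
    ∫⁻ x, ‖φ (x + h) - φ x‖ₑ ^ 2 ≤ ‖h‖ₑ ^ 2 * ∫⁻ x, ‖gradient φ x‖ₑ ^ 2 := by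
  have hg := φ.continuous_gradient
  have hm : Measurable (Function.uncurry fun (x : EuclideanSpace ℝ (Fin N)) (t : ℝ) =>
      ‖gradient φ (x + t • h)‖ₑ ^ 2) := by
    have : Continuous fun p : EuclideanSpace ℝ (Fin N) × ℝ => gradient φ (p.1 + p.2 • h) := by
      fun_prop
    exact this.measurable.enorm.pow_const _
  calc _ ≤ ∫⁻ x, ‖h‖ₑ ^ 2 * ∫⁻ t in Set.Ioc (0 : ℝ) 1, ‖gradient φ (x + t • h)‖ₑ ^ 2 :=
        lintegral_mono fun x => φ.sq_enorm_add_sub_le x h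
    _ = ‖h‖ₑ ^ 2 * ∫⁻ x, ∫⁻ t in Set.Ioc (0 : ℝ) 1, ‖gradient φ (x + t • h)‖ₑ ^ 2 :=
        lintegral_const_mul _ hm.lintegral_prod_right'
    _ = ‖h‖ₑ ^ 2 * ∫⁻ t in Set.Ioc (0 : ℝ) 1, ∫⁻ x, ‖gradient φ (x + t • h)‖ₑ ^ 2 := by
        rw [lintegral_lintegral_swap hm.aemeasurable]
    _ = _ := by
        congr 1
        have : ∀ t : ℝ, ∫⁻ x, ‖gradient φ (x + t • h)‖ₑ ^ 2 = ∫⁻ x, ‖gradient φ x‖ₑ ^ 2 :=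
          fun t => lintegral_add_right_eq_self (fun x => ‖gradient φ x‖ₑ ^ 2) (t • h)
        simp [this]

end TestFunction

/-! ### Approximation by averages over grid cubes. -/

/-- The cubes of side `δ` with vertices in `δ ℤ^N`. -/
def gridCell (δ : ℝ) (k : Fin N → ℤ) : Set (EuclideanSpace ℝ (Fin N)) :=
  {x | ∀ i, ⌊x i / δ⌋ = k i}

theorem mem_gridCell_self (δ : ℝ) (x : EuclideanSpace ℝ (Fin N)) :
    x ∈ gridCell δ (fun i => ⌊x i / δ⌋) := fun _ => rfl

theorem measurableSet_gridCell (δ : ℝ) (k : Fin N → ℤ) : MeasurableSet (gridCell δ k) := by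
  have : gridCell δ k = ⋂ i, (fun x : EuclideanSpace ℝ (Fin N) => ⌊x i / δ⌋) ⁻¹' {k i} := by
    ext x; simp [gridCell]
  rw [this]
  refine MeasurableSet.iInter fun i => ?_
  have : Measurable fun x : EuclideanSpace ℝ (Fin N) => ⌊x i / δ⌋ :=
    Int.measurable_floor.comp (by fun_prop)
  exact this (measurableSet_singleton _)

theorem volume_gridCell {δ : ℝ} (hδ : 0 < δ) (k : Fin N → ℤ) :
    volume (gridCell δ k) = ENNReal.ofReal δ ^ N := by
  have : gridCell δ k = (WithLp.ofLp : EuclideanSpace ℝ (Fin N) → Fin N → ℝ) ⁻¹'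
      (Set.univ.pi fun i => Set.Ico (k i * δ) (k i * δ + δ)) := by
    ext x
    simp only [gridCell, Set.mem_ofPred_eq, Set.mem_preimage, Set.mem_univ_pi, Set.mem_Ico]
    refine forall_congr' fun i => ?_
    rw [Int.floor_eq_iff, le_div_iff₀ hδ, div_lt_iff₀ hδ, add_mul, one_mul]
  rw [this, (PiLp.volume_preserving_ofLp (Fin N)).measure_preimage
    (MeasurableSet.univ_pi fun i => measurableSet_Ico).nullMeasurableSet, Real.volume_pi_Ico]
  simp

theorem norm_sub_le_of_mem_gridCell {δ : ℝ} (hδ : 0 < δ) {k : Fin N → ℤ}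
    {x y : EuclideanSpace ℝ (Fin N)} (hx : x ∈ gridCell δ k) (hy : y ∈ gridCell δ k) :
    ‖y - x‖ ≤ √N * δ := by
  have h : ∀ i, ‖(y - x) i‖ ^ 2 ≤ δ ^ 2 := fun i => by
    have h1 : |y i / δ - x i / δ| < 1 := Int.abs_sub_lt_one_of_floor_eq_floor
      ((hy i).trans (hx i).symm)
    rw [← sub_div, abs_div, abs_of_pos hδ, div_lt_one hδ] at h1
    gcongr
    exact h1.le
  rw [EuclideanSpace.norm_eq]
  calc _ ≤ √(∑ _i : Fin N, δ ^ 2) := Real.sqrt_le_sqrt (Finset.sum_le_sum fun i _ => h i)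
    _ = _ := by
      rw [Finset.sum_const, Finset.card_univ, Fintype.card_fin, nsmul_eq_mul,
        Real.sqrt_mul (by positivity), Real.sqrt_sq hδ.le]

/-- The mean value of `f` on the cube of the grid of side `δ` that contains `x`. -/
def gridAverage (δ : ℝ) (f : EuclideanSpace ℝ (Fin N) → ℝ) (x : EuclideanSpace ℝ (Fin N)) : ℝ :=
  (δ ^ N)⁻¹ * ∫ y in gridCell δ (fun i => ⌊x i / δ⌋), f y

/-- By Cauchy-Schwarz, the squared deviation from a mean is at most the mean of the squared
deviations. Writing the points of the cube as `x + h`, the displacement stays in a ball that does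
not depend on `x`, which prepares the exchange of integrals in `x` and `h`. -/
theorem TestFunction.sq_enorm_sub_gridAverage_le (φ : 𝓓(Ω, ℝ)) {δ : ℝ} (hδ : 0 < δ)
    (x : EuclideanSpace ℝ (Fin N)) :
    ‖φ x - gridAverage δ φ x‖ₑ ^ 2 ≤ (ENNReal.ofReal δ ^ N)⁻¹ *
      ∫⁻ h in Metric.closedBall (0 : EuclideanSpace ℝ (Fin N)) (√N * δ),
        ‖φ (x + h) - φ x‖ₑ ^ 2 := by
  set Q : Set (EuclideanSpace ℝ (Fin N)) := gridCell δ (fun i => ⌊x i / δ⌋) with hQ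
  have hm0 : ENNReal.ofReal δ ^ N ≠ 0 := by simp [hδ]
  have hm1 : ENNReal.ofReal δ ^ N ≠ ∞ := by simp
  have hvol : volume Q = ENNReal.ofReal δ ^ N := volume_gridCell hδ _
  have hφm := φ.continuous.measurable
  have hmeas : Measurable fun y => ‖φ y - φ x‖ₑ := (hφm.sub_const _).enorm
  have hint : Integrable φ (volume.restrict Q) :=
    (φ.continuous.integrable_of_hasCompactSupport φ.hasCompactSupport).restrict
  have hconst : IntegrableOn (fun _ : EuclideanSpace ℝ (Fin N) => φ x) Q :=
    integrableOn_const (by rw [hvol]; exact hm1)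
  have e : gridAverage δ φ x - φ x = (δ ^ N)⁻¹ * ∫ y in Q, (φ y - φ x) := by
    rw [integral_sub hint hconst, setIntegral_const, Measure.real, hvol, ENNReal.toReal_pow,
      ENNReal.toReal_ofReal hδ.le, gridAverage, smul_eq_mul]
    field_simp
    rfl
  have e1 : ‖(δ ^ N)⁻¹‖ₑ = (ENNReal.ofReal δ ^ N)⁻¹ := by
    rw [enorm_inv (by positivity), enorm_pow, Real.enorm_of_nonneg hδ.le]
  have h1 : ‖gridAverage δ φ x - φ x‖ₑ ≤
      (ENNReal.ofReal δ ^ N)⁻¹ * ∫⁻ y in Q, ‖φ y - φ x‖ₑ := by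
    rw [e, enorm_mul, e1]
    gcongr
    exact enorm_integral_le_lintegral_enorm _
  have h2 : ∫⁻ y in Q, ‖φ y - φ x‖ₑ ^ 2 ≤
      ∫⁻ h in Metric.closedBall (0 : EuclideanSpace ℝ (Fin N)) (√N * δ),
        ‖φ (x + h) - φ x‖ₑ ^ 2 := by
    rw [← lintegral_indicator Metric.isClosed_closedBall.measurableSet,
      ← lintegral_indicator (measurableSet_gridCell _ _),
      ← lintegral_add_left_eq_self (Q.indicator _) x]
    refine lintegral_mono fun h => ?_
    by_cases hh : x + h ∈ Q
    · have : h ∈ Metric.closedBall (0 : EuclideanSpace ℝ (Fin N)) (√N * δ) := by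
        have := norm_sub_le_of_mem_gridCell hδ (mem_gridCell_self δ x) hh
        simpa using this
      rw [Set.indicator_of_mem hh, Set.indicator_of_mem this]
    · rw [Set.indicator_of_notMem hh]
      exact zero_le
  rw [enorm_sub_rev]
  calc _ ≤ ((ENNReal.ofReal δ ^ N)⁻¹ * ∫⁻ y in Q, ‖φ y - φ x‖ₑ) ^ 2 := by gcongr
    _ ≤ ((ENNReal.ofReal δ ^ N)⁻¹) ^ 2 *
        (ENNReal.ofReal δ ^ N * ∫⁻ y in Q, ‖φ y - φ x‖ₑ ^ 2) := by
      rw [mul_pow]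
      gcongr
      simpa [hvol] using sq_lintegral_le (μ := volume.restrict Q) hmeas.aemeasurable
    _ = (ENNReal.ofReal δ ^ N)⁻¹ * ∫⁻ y in Q, ‖φ y - φ x‖ₑ ^ 2 := by
      rw [sq, mul_assoc, ← mul_assoc _ (ENNReal.ofReal δ ^ N), ENNReal.inv_mul_cancel hm0 hm1,
        one_mul]
    _ ≤ _ := by gcongr

/-- After Fubini, the translation estimate applies for each `h` in the ball. The ball and the cube
both have volume proportional to `δ^N`, so only the factor `|h|² ≤ N δ²` depends on `δ`. -/
theorem exists_lintegral_sq_enorm_sub_gridAverage_le (Ω : Opens (EuclideanSpace ℝ (Fin N))) :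
    ∃ C : ℝ≥0∞, C ≠ ∞ ∧ ∀ (δ : ℝ), 0 < δ → ∀ φ : 𝓓(Ω, ℝ),
      ∫⁻ x, ‖φ x - gridAverage δ φ x‖ₑ ^ 2 ≤
        (C * ENNReal.ofReal δ) ^ 2 * ∫⁻ x, ‖gradient φ x‖ₑ ^ 2 := by
  set v := volume (Metric.closedBall (0 : EuclideanSpace ℝ (Fin N)) 1)
  have hv : v ≠ ∞ := measure_closedBall_lt_top.ne
  set K : ℝ≥0∞ := (ENNReal.ofReal √N) ^ N * v * ENNReal.ofReal √N ^ 2 with hK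
  have hK' : K ≠ ∞ := by finiteness
  -- The estimate produces `K δ²`; using `K ≤ (K + 1)²` puts it in the squared form without a square
  -- root.
  refine ⟨K + 1, by finiteness, fun δ hδ φ => ?_⟩
  have hm0 : ENNReal.ofReal δ ^ N ≠ 0 := by simp [hδ]
  have hm1 : ENNReal.ofReal δ ^ N ≠ ∞ := by simp
  set B := Metric.closedBall (0 : EuclideanSpace ℝ (Fin N)) (√N * δ) with hB
  have hBv : volume B = ENNReal.ofReal δ ^ N * (ENNReal.ofReal √N ^ N * v) := by
    rw [hB, Measure.addHaar_closedBall' _ _ (by positivity), finrank_euclideanSpace_fin,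
      ENNReal.ofReal_pow (by positivity), ENNReal.ofReal_mul (by positivity), mul_pow]
    ring
  have hm : Measurable (Function.uncurry fun x h : EuclideanSpace ℝ (Fin N) =>
      ‖φ (x + h) - φ x‖ₑ ^ 2) := by
    have := φ.continuous
    have : Continuous fun p : EuclideanSpace ℝ (Fin N) × EuclideanSpace ℝ (Fin N) =>
        φ (p.1 + p.2) - φ p.1 := by fun_prop
    exact this.measurable.enorm.pow_const _
  set D := ∫⁻ x, ‖gradient φ x‖ₑ ^ 2
  calc _ ≤ ∫⁻ x, (ENNReal.ofReal δ ^ N)⁻¹ * ∫⁻ h in B, ‖φ (x + h) - φ x‖ₑ ^ 2 :=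
        lintegral_mono fun x => φ.sq_enorm_sub_gridAverage_le hδ x
    _ = (ENNReal.ofReal δ ^ N)⁻¹ * ∫⁻ h in B, ∫⁻ x, ‖φ (x + h) - φ x‖ₑ ^ 2 := by
        rw [← lintegral_lintegral_swap hm.aemeasurable]
        exact lintegral_const_mul _ hm.lintegral_prod_right'
    _ ≤ (ENNReal.ofReal δ ^ N)⁻¹ * ∫⁻ h in B, ENNReal.ofReal (√N * δ) ^ 2 * D := by
        refine mul_le_mul_right ?_ _
        refine setLIntegral_mono' Metric.isClosed_closedBall.measurableSet fun h hh => ?_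
        refine (φ.lintegral_sq_enorm_add_sub_le h).trans ?_
        gcongr
        rw [← ofReal_norm]
        exact ENNReal.ofReal_le_ofReal (by simpa [hB] using hh)
    _ = (ENNReal.ofReal δ ^ N)⁻¹ * ENNReal.ofReal δ ^ N * (K * ENNReal.ofReal δ ^ 2 * D) := by
        rw [setLIntegral_const, hBv, ENNReal.ofReal_mul (by positivity), hK]
        ring
    _ = K * ENNReal.ofReal δ ^ 2 * D := by rw [ENNReal.inv_mul_cancel hm0 hm1, one_mul]
    _ ≤ (K + 1) ^ 2 * ENNReal.ofReal δ ^ 2 * D := by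
        gcongr
        calc K ≤ K + 1 := le_self_add
          _ = (K + 1) * 1 := (mul_one _).symm
          _ ≤ (K + 1) * (K + 1) := by gcongr; exact le_add_self
          _ = _ := (sq _).symm
    _ = _ := by rw [mul_pow]

/-! ### Rellich compactness. -/

/-- The finite rank operator averaging over the cubes of side `δ` with index in `S`. -/
def gridProjection (Ω : Opens (EuclideanSpace ℝ (Fin N))) [IsFiniteMeasure (domainMeasure Ω)]
    (δ : ℝ) (S : Finset (Fin N → ℤ)) :
    Lp ℝ 2 (domainMeasure Ω) →L[ℝ] Lp ℝ 2 (domainMeasure Ω) :=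
  ∑ k ∈ S, (δ ^ N)⁻¹ • InnerProductSpace.rankOne ℝ
    (indicatorConstLp 2 (measurableSet_gridCell δ k) (measure_ne_top (domainMeasure Ω) _) (1 : ℝ))
    (indicatorConstLp 2 (measurableSet_gridCell δ k) (measure_ne_top (domainMeasure Ω) _) (1 : ℝ))

theorem isCompactOperator_gridProjection (Ω : Opens (EuclideanSpace ℝ (Fin N)))
    [IsFiniteMeasure (domainMeasure Ω)] (δ : ℝ) (S : Finset (Fin N → ℤ)) :
    IsCompactOperator (gridProjection Ω δ S) := by
  have h : ∀ k ∈ S, (δ ^ N)⁻¹ • InnerProductSpace.rankOne ℝ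
      (indicatorConstLp 2 (measurableSet_gridCell δ k) (measure_ne_top (domainMeasure Ω) _)
        (1 : ℝ))
      (indicatorConstLp 2 (measurableSet_gridCell δ k) (measure_ne_top (domainMeasure Ω) _)
        (1 : ℝ)) ∈ compactOperator (RingHom.id ℝ) (Lp ℝ 2 (domainMeasure Ω))
          (Lp ℝ 2 (domainMeasure Ω)) := fun k _ => by
    refine Submodule.smul_mem _ _ ?_
    rw [InnerProductSpace.rankOne_def']
    have hc : IsCompactOperator (ContinuousLinearMap.toSpanSingleton ℝ
        (indicatorConstLp 2 (measurableSet_gridCell δ k) (measure_ne_top (domainMeasure Ω) _)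
          (1 : ℝ))) :=
      isCompactOperator_of_locallyCompactSpace_rng _
    exact hc.comp_clm _
  exact Submodule.sum_mem _ h

theorem gridProjection_toLp (Ω : Opens (EuclideanSpace ℝ (Fin N)))
    [IsFiniteMeasure (domainMeasure Ω)] {δ : ℝ} {S : Finset (Fin N → ℤ)}
    (hS : ∀ x ∈ Ω, (fun i => ⌊x i / δ⌋) ∈ S) (φ : 𝓓(Ω, ℝ)) :
    gridProjection Ω δ S ((φ.memLp 2 _).toLp φ) =ᵐ[domainMeasure Ω] gridAverage δ φ := by
  have hsum : gridProjection Ω δ S ((φ.memLp 2 _).toLp φ) =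
      ∑ k ∈ S, indicatorConstLp 2 (measurableSet_gridCell δ k)
        (measure_ne_top (domainMeasure Ω) _) ((δ ^ N)⁻¹ * ∫ y in gridCell δ k, φ y) := by
    rw [gridProjection, sum_apply]
    refine Finset.sum_congr rfl fun k _ => ?_
    -- A cube may stick out of `Ω`, but `φ` vanishes there, so normalizing by the full volume `δ^N`
    -- is consistent with `gridAverage`.
    have hin : ∫ y in gridCell δ k, ((φ.memLp 2 (domainMeasure Ω)).toLp φ) y ∂(domainMeasure Ω) =
        ∫ y in gridCell δ k, φ y := by
      rw [setIntegral_congr_ae (g := φ) (measurableSet_gridCell δ k)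
        ((MemLp.coeFn_toLp _).mono fun x hx _ => hx),
        Measure.restrict_restrict (measurableSet_gridCell δ k), Set.inter_comm,
        ← Measure.restrict_restrict Ω.isOpen.measurableSet]
      exact setIntegral_eq_integral_of_forall_compl_eq_zero fun x hx => φ.eq_zero_of_notMem hx
    rw [smul_apply, InnerProductSpace.rankOne_apply,
      L2.inner_indicatorConstLp_one, hin, smul_smul]
    ext1
    filter_upwards [Lp.coeFn_smul ((δ ^ N)⁻¹ * ∫ y in gridCell δ k, φ y)
      (indicatorConstLp 2 (measurableSet_gridCell δ k) (measure_ne_top (domainMeasure Ω) _)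
        (1 : ℝ)), indicatorConstLp_coeFn (p := 2) (hs := measurableSet_gridCell δ k)
        (hμs := measure_ne_top (domainMeasure Ω) _) (c := (1 : ℝ)),
        indicatorConstLp_coeFn (p := 2) (hs := measurableSet_gridCell δ k)
        (hμs := measure_ne_top (domainMeasure Ω) _)
        (c := (δ ^ N)⁻¹ * ∫ y in gridCell δ k, φ y)] with x h1 h2 h3
    rw [h1, h3, Pi.smul_apply, h2]
    by_cases hx : x ∈ gridCell δ k <;> simp [hx]
  rw [hsum]
  have hall : ∀ᵐ x ∂(domainMeasure Ω), ∀ k : Fin N → ℤ,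
      indicatorConstLp 2 (measurableSet_gridCell δ k) (measure_ne_top (domainMeasure Ω) _)
        ((δ ^ N)⁻¹ * ∫ y in gridCell δ k, φ y) x =
      (gridCell δ k).indicator (fun _ => (δ ^ N)⁻¹ * ∫ y in gridCell δ k, φ y) x :=
    ae_all_iff.2 fun k => indicatorConstLp_coeFn
  filter_upwards [hall, Lp.coeFn_finsetSum S fun k => indicatorConstLp 2
    (measurableSet_gridCell δ k) (measure_ne_top (domainMeasure Ω) _)
    ((δ ^ N)⁻¹ * ∫ y in gridCell δ k, φ y), ae_restrict_mem Ω.isOpen.measurableSet]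
    with x h1 h2 hx
  rw [h2, Finset.sum_apply, Finset.sum_congr rfl fun k _ => h1 k,
    Finset.sum_eq_single_of_mem _ (hS x hx)]
  · rw [Set.indicator_of_mem (mem_gridCell_self δ x), gridAverage]
  · intro k _ hk
    refine Set.indicator_of_notMem (fun hx => hk ?_) _
    exact funext fun i => (hx i).symm

theorem exists_finset_floor_mem (hΩ : Bornology.IsBounded (Ω : Set (EuclideanSpace ℝ (Fin N))))
    (δ : ℝ) : ∃ S : Finset (Fin N → ℤ), ∀ x ∈ Ω, (fun i => ⌊x i / δ⌋) ∈ S := by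
  obtain ⟨R, hR⟩ := hΩ.exists_norm_le
  refine ⟨Fintype.piFinset fun _ => Finset.Icc ⌊-(R / |δ|)⌋ ⌊R / |δ|⌋, fun x hx => ?_⟩
  rw [Fintype.mem_piFinset]
  intro i
  have h : |x i / δ| ≤ R / |δ| := by
    rw [abs_div]
    gcongr
    exact (PiLp.norm_apply_le x i).trans (hR x hx)
  rw [abs_le] at h
  exact Finset.mem_Icc.2 ⟨Int.floor_le_floor h.1, Int.floor_le_floor h.2⟩

theorem isFiniteMeasure_domainMeasure
    (hΩ : Bornology.IsBounded (Ω : Set (EuclideanSpace ℝ (Fin N)))) :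
    IsFiniteMeasure (domainMeasure Ω) :=
  isFiniteMeasure_restrict.2 hΩ.measure_lt_top.ne

theorem norm_toLp_sub_gridProjection_le (Ω : Opens (EuclideanSpace ℝ (Fin N)))
    [IsFiniteMeasure (domainMeasure Ω)] {δ C : ℝ} (hδ : 0 ≤ δ) (hC : 0 ≤ C)
    {S : Finset (Fin N → ℤ)} (hS : ∀ x ∈ Ω, (fun i => ⌊x i / δ⌋) ∈ S) (φ : 𝓓(Ω, ℝ))
    (h : ∫⁻ x, ‖φ x - gridAverage δ φ x‖ₑ ^ 2 ≤
      (ENNReal.ofReal C * ENNReal.ofReal δ) ^ 2 * ∫⁻ x, ‖gradient φ x‖ₑ ^ 2) :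
    ‖(φ.memLp 2 (domainMeasure Ω)).toLp φ -
        gridProjection Ω δ S ((φ.memLp 2 (domainMeasure Ω)).toLp φ)‖ ≤
      C * δ * ‖(φ.memLp_gradient 2 (domainMeasure Ω)).toLp (gradient φ)‖ := by
  set f := (φ.memLp 2 (domainMeasure Ω)).toLp φ with hf
  have e : (f - gridProjection Ω δ S f : Lp ℝ 2 (domainMeasure Ω)) =ᵐ[domainMeasure Ω]
      fun x => φ x - gridAverage δ φ x := by
    filter_upwards [gridProjection_toLp Ω hS φ, (φ.memLp 2 (domainMeasure Ω)).coeFn_toLp,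
      Lp.coeFn_sub f (gridProjection Ω δ S f)] with x h1 h2 h3
    rw [h3, Pi.sub_apply, h1, h2]
  have e2 : ∫⁻ x, ‖gradient φ x‖ₑ ^ 2 =
      ‖(φ.memLp_gradient 2 (domainMeasure Ω)).toLp (gradient φ)‖ₑ ^ 2 := by
    rw [Lp.enorm_toLp, eLpNorm_two_sq, setLIntegral_eq_of_support_subset]
    intro x hx
    by_contra hx'
    exact hx (by simp [φ.gradient_eq_zero_of_notMem hx'])
  have h1 : ‖f - gridProjection Ω δ S f‖ₑ ^ 2 ≤ (ENNReal.ofReal C * ENNReal.ofReal δ *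
      ‖(φ.memLp_gradient 2 (domainMeasure Ω)).toLp (gradient φ)‖ₑ) ^ 2 := by
    rw [Lp.enorm_def, eLpNorm_congr_ae e, eLpNorm_two_sq, mul_pow, ← e2]
    exact (setLIntegral_le_lintegral _ _).trans h
  have h2 := (ENNReal.pow_le_pow_left_iff (n := 2) (by norm_num)).1 h1
  have h3 := ENNReal.toReal_mono (by finiteness) h2
  rwa [ENNReal.toReal_mul, ENNReal.toReal_mul, ENNReal.toReal_ofReal hδ,
    ENNReal.toReal_ofReal hC, toReal_enorm, toReal_enorm] at h3

/-- The estimate is a closed condition on the pair, so it passes from test functions to their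
closure. Boundedness of `Ω` leaves finitely many cubes, hence a finite rank operator. -/
theorem exists_isCompactOperator_norm_sub_le
    (hΩ : Bornology.IsBounded (Ω : Set (EuclideanSpace ℝ (Fin N)))) :
    ∃ C : ℝ, ∀ δ : ℝ, 0 < δ →
      ∃ P : Lp ℝ 2 (domainMeasure Ω) →L[ℝ] Lp ℝ 2 (domainMeasure Ω), IsCompactOperator P ∧
        ∀ v ∈ h10 Ω, ‖v.1 - P v.1‖ ≤ C * δ * ‖v‖ := by
  have := isFiniteMeasure_domainMeasure hΩ
  obtain ⟨C, hC, h⟩ := exists_lintegral_sq_enorm_sub_gridAverage_le Ω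
  refine ⟨C.toReal, fun δ hδ => ?_⟩
  obtain ⟨S, hS⟩ := exists_finset_floor_mem hΩ δ
  refine ⟨gridProjection Ω δ S, isCompactOperator_gridProjection Ω δ S, ?_⟩
  generalize hP : gridProjection Ω δ S = P
  set T : Set (Lp ℝ 2 (domainMeasure Ω) × Lp (EuclideanSpace ℝ (Fin N)) 2 (domainMeasure Ω)) :=
    {v | ‖v.1 - P v.1‖ ≤ C.toReal * δ * ‖v‖}
  have hclosed : IsClosed T :=
    isClosed_le (continuous_fst.sub (P.continuous.comp continuous_fst)).norm
      (continuous_const.mul continuous_norm)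
  suffices h' : (LinearMap.range (testPair Ω) : Set (Lp ℝ 2 (domainMeasure Ω) ×
      Lp (EuclideanSpace ℝ (Fin N)) 2 (domainMeasure Ω))) ⊆ T from
    fun v hv => closure_minimal h' hclosed hv
  rintro _ ⟨φ, rfl⟩
  have h1 := norm_toLp_sub_gridProjection_le Ω hδ.le ENNReal.toReal_nonneg hS φ
    (by rw [ENNReal.ofReal_toReal hC]; exact h δ hδ φ)
  rw [hP] at h1
  exact h1.trans (mul_le_mul_of_nonneg_left (norm_snd_le (testPair Ω φ))
    (mul_nonneg ENNReal.toReal_nonneg hδ.le))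

/-- The embedding of `H¹₀(Ω)` into `L²(Ω)`. -/
def h10Embedding (Ω : Opens (EuclideanSpace ℝ (Fin N))) :
    h10 Ω →L[ℝ] Lp ℝ 2 (domainMeasure Ω) :=
  (ContinuousLinearMap.fst ℝ _ _).comp (h10 Ω).subtypeL

/-- The **Rellich-Kondrachov theorem** for `H¹₀(Ω)`, `Ω` bounded. -/
theorem isCompactOperator_h10Embedding
    (hΩ : Bornology.IsBounded (Ω : Set (EuclideanSpace ℝ (Fin N)))) :
    IsCompactOperator (h10Embedding Ω) := by
  obtain ⟨C, h⟩ := exists_isCompactOperator_norm_sub_le hΩ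
  -- With grid size `1/(n+1)`, the compact operators `Pₙ ∘ J` converge in operator norm to the
  -- embedding `J`.
  choose P hP hPC using fun n : ℕ => h (n + 1 : ℝ)⁻¹ (by positivity)
  refine isCompactOperator_of_tendsto (l := atTop) (F := fun n => (P n).comp (h10Embedding Ω)) ?_
    (Eventually.of_forall fun n => (hP n).comp_clm _)
  rw [tendsto_iff_norm_sub_tendsto_zero]
  have h0 : Tendsto (fun n : ℕ => max C 0 * (n + 1 : ℝ)⁻¹) atTop (𝓝 0) := by
    simpa using (tendsto_one_div_add_atTop_nhds_zero_nat (𝕜 := ℝ)).const_mul (max C 0)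
  refine squeeze_zero (fun _ => norm_nonneg _) (fun n => ?_) h0
  refine ContinuousLinearMap.opNorm_le_bound _ (by positivity) fun v => ?_
  rw [sub_apply, norm_sub_rev]
  refine (hPC n v v.2).trans ?_
  gcongr
  · exact le_max_left _ _
  · rfl

/-! ### Minimization of an abstract Rayleigh quotient. -/

section Rayleigh

variable {V H : Type*} [NormedAddCommGroup V] [NormedSpace ℝ V] [CompleteSpace V]
  [NormedAddCommGroup H] [InnerProductSpace ℝ H]

/-- Existence of a minimizer of the Rayleigh quotient. -/
theorem exists_isMinOn_rayleigh (B : V →L[ℝ] V →L[ℝ] ℝ) (J : V →L[ℝ] H)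
    (hJ : IsCompactOperator J) {α : ℝ} (hα : 0 < α)
    (hB : ∀ v, α * ‖v‖ ^ 2 ≤ B v v + α * ‖J v‖ ^ 2) {v₀ : V} (hv₀ : J v₀ ≠ 0) :
    ∃ (μ : ℝ) (u : V), J u ≠ 0 ∧ B u u = μ * ‖J u‖ ^ 2 ∧ ∀ v, μ * ‖J v‖ ^ 2 ≤ B v v := by
  set S : Set ℝ := (fun v => B v v) '' {v | ‖J v‖ = 1} with hS
  have hnorm : ∀ v, J v ≠ 0 → ‖J (‖J v‖⁻¹ • v)‖ = 1 := fun v hv => by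
    rw [map_smul, norm_smul, norm_inv, norm_norm, inv_mul_cancel₀ (norm_ne_zero_iff.2 hv)]
  have hSne : S.Nonempty := ⟨_, _, hnorm v₀ hv₀, rfl⟩
  have hSbdd : BddBelow S := by
    refine ⟨-α, ?_⟩
    rintro _ ⟨v, hv, rfl⟩
    have h1 := hB v
    rw [Set.mem_ofPred_eq] at hv
    rw [hv] at h1
    have : 0 ≤ α * ‖v‖ ^ 2 := by positivity
    simp only
    linarith
  set μ := sInf S with hμ
  have hmin : ∀ v, μ * ‖J v‖ ^ 2 ≤ B v v := fun v => by
    by_cases hv : J v = 0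
    · have h1 := hB v
      have : 0 ≤ α * ‖v‖ ^ 2 := by positivity
      simp only [hv, norm_zero] at h1 ⊢
      linarith
    · have h1 : μ ≤ B (‖J v‖⁻¹ • v) (‖J v‖⁻¹ • v) := csInf_le hSbdd ⟨_, hnorm v hv, rfl⟩
      have hp : 0 < ‖J v‖ := norm_pos_iff.2 hv
      simp only [map_smul, _root_.smul_apply, smul_eq_mul] at h1
      rw [← mul_assoc, ← sq, inv_pow, inv_mul_eq_div, le_div_iff₀ (by positivity)] at h1
      exact h1
  obtain ⟨s, -, hs, hsS⟩ := exists_seq_tendsto_sInf hSne hSbdd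
  choose w hw1 hw2 using hsS
  simp only [Set.mem_ofPred_eq] at hw1
  have hwt : Tendsto (fun n => B (w n) (w n)) atTop (𝓝 μ) := by simpa only [hw2] using hs
  obtain ⟨M, hM⟩ : ∃ M, ∀ n, ‖w n‖ ≤ M := by
    obtain ⟨b, hb⟩ := hwt.bddAbove_range
    -- On the constraint `‖J w‖ = 1`, coercivity reads `α ‖w‖² ≤ B w w + α`.
    refine ⟨√((b + α) / α), fun n => Real.le_sqrt_of_sq_le ?_⟩
    rw [le_div_iff₀ hα]
    have h1 := hB (w n)
    have h2 : B (w n) (w n) ≤ b := hb ⟨n, rfl⟩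
    rw [hw1] at h1
    linarith
  obtain ⟨y, -, ns, hns, hy⟩ := (hJ.isCompact_closure_image_closedBall M).tendsto_subseq
    (x := fun n => J (w n)) fun n => subset_closure ⟨w n, by simpa using hM n, rfl⟩
  -- Strong convergence comes from a parallelogram argument. Expanding, `B(a-b, a-b) = 2B(a,a) +
  -- 2B(b,b) - B(a+b, a+b)`, and `B(a+b, a+b) ≥ μ ‖J(a+b)‖²`. As `J a - J b → 0` by compactness,
  -- `‖J(a+b)‖² → 4`, and the bound tends to `2μ + 2μ - 4μ = 0`.
  have hcauchy : CauchySeq (w ∘ ns) := by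
    have hyc := hy.cauchySeq
    have hq : Tendsto (fun p : ℕ × ℕ => (2 * B (w (ns p.1)) (w (ns p.1)) +
        2 * B (w (ns p.2)) (w (ns p.2)) -
        μ * (2 * ‖J (w (ns p.1))‖ ^ 2 + 2 * ‖J (w (ns p.2))‖ ^ 2 -
          ‖J (w (ns p.1)) - J (w (ns p.2))‖ ^ 2) +
        α * ‖J (w (ns p.1)) - J (w (ns p.2))‖ ^ 2) / α) (atTop ×ˢ atTop) (𝓝 0) := by
      have h1 : Tendsto (fun p : ℕ × ℕ => B (w (ns p.1)) (w (ns p.1))) (atTop ×ˢ atTop) (𝓝 μ) :=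
        (hwt.comp hns.tendsto_atTop).comp tendsto_fst
      have h2 : Tendsto (fun p : ℕ × ℕ => B (w (ns p.2)) (w (ns p.2))) (atTop ×ˢ atTop) (𝓝 μ) :=
        (hwt.comp hns.tendsto_atTop).comp tendsto_snd
      have h3 : Tendsto (fun p : ℕ × ℕ => ‖J (w (ns p.1)) - J (w (ns p.2))‖) (atTop ×ˢ atTop)
          (𝓝 0) := by
        simpa using ((hy.comp tendsto_fst).sub (hy.comp tendsto_snd)).norm
      have h4 := ((((h1.const_mul 2).add (h2.const_mul 2)).sub
        (((h3.pow 2).const_sub (2 * 1 ^ 2 + 2 * 1 ^ 2)).const_mul μ)).add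
        ((h3.pow 2).const_mul α)).div_const α
      simp only [hw1]
      convert h4 using 2
      ring
    refine cauchySeq_iff_tendsto_dist_atTop_0.2 ?_
    rw [← prod_atTop_atTop_eq]
    have hq' := (Real.continuous_sqrt.tendsto 0).comp hq
    rw [Real.sqrt_zero] at hq'
    refine squeeze_zero (fun _ => dist_nonneg) (fun p => ?_) hq'
    refine Real.le_sqrt_of_sq_le ?_
    rw [le_div_iff₀ hα, dist_eq_norm]
    simp only [Function.comp_apply]
    set a := w (ns p.1)
    set b := w (ns p.2)
    have h1 := hB (a - b)
    have h2 := hmin (a + b)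
    have h3 := parallelogram_law_with_norm ℝ (J a) (J b)
    simp only [map_add, map_sub, _root_.add_apply, _root_.sub_apply] at h1 h2
    have h4 : ‖J a + J b‖ ^ 2 = 2 * ‖J a‖ ^ 2 + 2 * ‖J b‖ ^ 2 - ‖J a - J b‖ ^ 2 := by linarith
    rw [h4] at h2
    linarith
  obtain ⟨u, hu⟩ := cauchySeq_tendsto_of_complete hcauchy
  have hJu : ‖J u‖ = 1 := by
    refine tendsto_nhds_unique ((J.continuous.tendsto u).comp hu).norm ?_
    simp [hw1]
  have hBu : B u u = μ := by
    have hc : Continuous fun v => B v v := by fun_prop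
    exact tendsto_nhds_unique ((hc.tendsto u).comp hu) (hwt.comp hns.tendsto_atTop)
  refine ⟨μ, u, norm_ne_zero_iff.1 (by simp [hJu]), by simp [hBu, hJu], hmin⟩

/-- A symmetric coercive form on a compactly embedded space has an eigenvalue below each of its
Rayleigh quotients. -/
theorem exists_eigenvector_le_rayleigh (B : V →L[ℝ] V →L[ℝ] ℝ) (hsymm : ∀ v w, B v w = B w v)
    (J : V →L[ℝ] H) (hJ : IsCompactOperator J) {α : ℝ} (hα : 0 < α)
    (hB : ∀ v, α * ‖v‖ ^ 2 ≤ B v v + α * ‖J v‖ ^ 2) {v₀ : V} (hv₀ : J v₀ ≠ 0) {c : ℝ}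
    (hc : B v₀ v₀ ≤ c * ‖J v₀‖ ^ 2) :
    ∃ μ ≤ c, ∃ u : V, J u ≠ 0 ∧ ∀ v, B u v = μ * inner ℝ (J u) (J v) := by
  obtain ⟨μ, u, hu, hBu, hmin⟩ := exists_isMinOn_rayleigh B J hJ hα hB hv₀
  refine ⟨μ, ?_, u, hu, fun v => ?_⟩
  · have : 0 < ‖J v₀‖ ^ 2 := by positivity
    exact le_of_mul_le_mul_right ((hmin v₀).trans hc) this
  · have key : ∀ t : ℝ, 0 ≤ (B v v - μ * ‖J v‖ ^ 2) * (t * t) +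
        2 * (B u v - μ * inner ℝ (J u) (J v)) * t + 0 := fun t => by
      have h := hmin (u + t • v)
      have e := norm_add_sq_real (J u) (t • J v)
      rw [inner_smul_right, norm_smul, mul_pow, Real.norm_eq_abs, sq_abs] at e
      simp only [map_add, map_smul, _root_.add_apply, _root_.smul_apply, smul_eq_mul, e,
        hsymm v u, hBu] at h
      linarith
    have := discrim_le_zero key
    rw [discrim] at this
    have h2 : (B u v - μ * inner ℝ (J u) (J v)) ^ 2 ≤ 0 := by linarith
    exact sub_eq_zero.1 (pow_eq_zero_iff two_ne_zero |>.1 (le_antisymm h2 (sq_nonneg _)))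

end Rayleigh

/-! ### The Dirichlet form and its eigenvalues. -/

theorem inner_toEuclideanLin_eq_sum (M : Matrix (Fin N) (Fin N) ℝ)
    (ξ η : EuclideanSpace ℝ (Fin N)) :
    inner ℝ (Matrix.toEuclideanLin M ξ) η = ∑ i, ∑ j, M i j * ξ j * η i := by
  simp only [PiLp.inner_apply, Matrix.ofLp_toLpLin, Matrix.toLin'_apply, Matrix.mulVec,
    dotProduct, RCLike.inner_apply, conj_trivial, Finset.mul_sum]
  exact Finset.sum_congr rfl fun i _ => Finset.sum_congr rfl fun j _ => mul_comm _ _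

theorem IsBoundedCoercive.exists_bound
    {A : EuclideanSpace ℝ (Fin N) → Matrix (Fin N) (Fin N) ℝ} (hA : IsBoundedCoercive Ω A) :
    ∃ K, 0 ≤ K ∧ ∀ᵐ x ∂(domainMeasure Ω), ∀ ξ η : EuclideanSpace ℝ (Fin N),
      |inner ℝ (Matrix.toEuclideanLin (A x) ξ) η| ≤ K * (‖ξ‖ * ‖η‖) := by
  refine ⟨∑ i, ∑ j, (eLpNorm (fun x => A x i j) ∞ (domainMeasure Ω)).toReal,
    Finset.sum_nonneg fun i _ => Finset.sum_nonneg fun j _ => ENNReal.toReal_nonneg, ?_⟩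
  have h : ∀ᵐ x ∂(domainMeasure Ω), ∀ i j,
      |A x i j| ≤ (eLpNorm (fun x => A x i j) ∞ (domainMeasure Ω)).toReal := by
    refine ae_all_iff.2 fun i => ae_all_iff.2 fun j => ?_
    have hfin := (hA.memLp_top i j).2.ne
    filter_upwards [enorm_ae_le_eLpNormEssSup (fun x => A x i j) (domainMeasure Ω)] with x hx
    rw [← eLpNorm_exponent_top] at hx
    have := ENNReal.toReal_mono hfin hx
    rwa [toReal_enorm] at this
  filter_upwards [h] with x hx ξ η
  rw [inner_toEuclideanLin_eq_sum, Finset.sum_mul]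
  refine (Finset.abs_sum_le_sum_abs _ _).trans (Finset.sum_le_sum fun i _ => ?_)
  rw [Finset.sum_mul]
  refine (Finset.abs_sum_le_sum_abs _ _).trans (Finset.sum_le_sum fun j _ => ?_)
  rw [mul_assoc, abs_mul, abs_mul]
  gcongr
  · exact hx i j
  · exact PiLp.norm_apply_le ξ j
  · exact PiLp.norm_apply_le η i

theorem IsBoundedCoercive.integrable_inner
    {A : EuclideanSpace ℝ (Fin N) → Matrix (Fin N) (Fin N) ℝ} (hA : IsBoundedCoercive Ω A)
    {U V : EuclideanSpace ℝ (Fin N) → EuclideanSpace ℝ (Fin N)}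
    (hU : MemLp U 2 (domainMeasure Ω)) (hV : MemLp V 2 (domainMeasure Ω)) :
    Integrable (fun x => inner ℝ (Matrix.toEuclideanLin (A x) (U x)) (V x)) (domainMeasure Ω) := by
  obtain ⟨K, -, hK⟩ := hA.exists_bound
  refine ((hU.norm.integrable_mul hV.norm).const_mul K).mono' ?_
    (hK.mono fun x hx => by simpa using hx (U x) (V x))
  simp only [inner_toEuclideanLin_eq_sum]
  have hcoord : ∀ {W : EuclideanSpace ℝ (Fin N) → EuclideanSpace ℝ (Fin N)} (i : Fin N),
      MemLp W 2 (domainMeasure Ω) → AEStronglyMeasurable (fun x => W x i) (domainMeasure Ω) :=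
    fun i hW => (EuclideanSpace.proj (𝕜 := ℝ) i).continuous.comp_aestronglyMeasurable hW.1
  exact Finset.aestronglyMeasurable_fun_sum _ fun i _ =>
    Finset.aestronglyMeasurable_fun_sum _ fun j _ =>
      ((hA.memLp_top i j).1.mul (hcoord j hU)).mul (hcoord i hV)

theorem dirichletForm_congr_ae {A : EuclideanSpace ℝ (Fin N) → Matrix (Fin N) (Fin N) ℝ}
    {U U' V V' : EuclideanSpace ℝ (Fin N) → EuclideanSpace ℝ (Fin N)}
    (hU : U =ᵐ[domainMeasure Ω] U') (hV : V =ᵐ[domainMeasure Ω] V') :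
    dirichletForm Ω A U V = dirichletForm Ω A U' V' :=
  integral_congr_ae <| by filter_upwards [hU, hV] with x h1 h2; rw [h1, h2]

/-- The bilinear form `(U, V) ↦ ∫_Ω A(x) U · V` on `L²(Ω)^N`. -/
def IsBoundedCoercive.form {A : EuclideanSpace ℝ (Fin N) → Matrix (Fin N) (Fin N) ℝ}
    (hA : IsBoundedCoercive Ω A) :
    Lp (EuclideanSpace ℝ (Fin N)) 2 (domainMeasure Ω) →L[ℝ]
      Lp (EuclideanSpace ℝ (Fin N)) 2 (domainMeasure Ω) →L[ℝ] ℝ :=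
  LinearMap.mkContinuous₂
    (LinearMap.mk₂ ℝ (fun U V => dirichletForm Ω A U V)
      (fun U U' V => by
        rw [dirichletForm_congr_ae (Lp.coeFn_add U U') EventuallyEq.rfl]
        simp only [dirichletForm, Pi.add_apply, map_add, inner_add_left]
        exact integral_add (hA.integrable_inner (Lp.memLp U) (Lp.memLp V))
          (hA.integrable_inner (Lp.memLp U') (Lp.memLp V)))
      (fun c U V => by
        rw [dirichletForm_congr_ae (Lp.coeFn_smul c U) EventuallyEq.rfl]
        simp only [dirichletForm, Pi.smul_apply, map_smul, real_inner_smul_left]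
        exact integral_const_mul _ _)
      (fun U V V' => by
        rw [dirichletForm_congr_ae EventuallyEq.rfl (Lp.coeFn_add V V')]
        simp only [dirichletForm, Pi.add_apply, inner_add_right]
        exact integral_add (hA.integrable_inner (Lp.memLp U) (Lp.memLp V))
          (hA.integrable_inner (Lp.memLp U) (Lp.memLp V')))
      (fun c U V => by
        rw [dirichletForm_congr_ae EventuallyEq.rfl (Lp.coeFn_smul c V)]
        simp only [dirichletForm, Pi.smul_apply, real_inner_smul_right]
        exact integral_const_mul _ _))
    hA.exists_bound.choose fun U V => by
      obtain ⟨hK0, hK⟩ := hA.exists_bound.choose_spec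
      have hi : Integrable (fun x => ‖U x‖ * ‖V x‖) (domainMeasure Ω) :=
        (Lp.memLp U).norm.integrable_mul (Lp.memLp V).norm
      rw [mul_assoc]
      calc _ ≤ ∫ x, hA.exists_bound.choose * (‖U x‖ * ‖V x‖) ∂(domainMeasure Ω) :=
            norm_integral_le_of_norm_le (hi.const_mul _) (hK.mono fun x hx => hx _ _)
        _ = hA.exists_bound.choose * ∫ x, ‖U x‖ * ‖V x‖ ∂(domainMeasure Ω) :=
            integral_const_mul _ _
        _ ≤ _ := by
            gcongr
            have h := real_inner_le_norm ((Lp.memLp U).norm.toLp) ((Lp.memLp V).norm.toLp)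
            rw [L2.inner_def, Lp.norm_toLp, Lp.norm_toLp, eLpNorm_norm, eLpNorm_norm] at h
            refine le_trans (le_of_eq (integral_congr_ae ?_)) h
            filter_upwards [(Lp.memLp U).norm.coeFn_toLp, (Lp.memLp V).norm.coeFn_toLp] with x h1 h2
            rw [h1, h2]
            exact mul_comm _ _

theorem integral_norm_sq_eq_norm_sq {α F : Type*} [MeasurableSpace α] {μ : Measure α}
    [NormedAddCommGroup F] [InnerProductSpace ℝ F] (f : Lp F 2 μ) :
    ∫ x, ‖f x‖ ^ 2 ∂μ = ‖f‖ ^ 2 := by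
  rw [← real_inner_self_eq_norm_sq, L2.inner_def]
  simp only [real_inner_self_eq_norm_sq]

/-- The antisymmetric part of a matrix contributes nothing to its quadratic form. This links the
energy of the nonsymmetric operator to the eigenvalues of its symmetrization. -/
theorem inner_symmetrized (A : EuclideanSpace ℝ (Fin N) → Matrix (Fin N) (Fin N) ℝ)
    (x ξ : EuclideanSpace ℝ (Fin N)) :
    inner ℝ (Matrix.toEuclideanLin (symmetrized A x) ξ) ξ =
      inner ℝ (Matrix.toEuclideanLin (A x) ξ) ξ := by
  have h : ∑ i, ∑ j, A x j i * ξ j * ξ i = ∑ i, ∑ j, A x i j * ξ j * ξ i := by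
    rw [Finset.sum_comm]
    exact Finset.sum_congr rfl fun i _ => Finset.sum_congr rfl fun j _ => by ring
  simp only [inner_toEuclideanLin_eq_sum, symmetrized, Matrix.smul_apply, Matrix.add_apply,
    Matrix.transpose_apply, smul_eq_mul, mul_add, add_mul, Finset.sum_add_distrib]
  simp only [mul_assoc, ← Finset.mul_sum] at h ⊢
  rw [h]
  ring

theorem IsBoundedCoercive.symmetrized
    {A : EuclideanSpace ℝ (Fin N) → Matrix (Fin N) (Fin N) ℝ} (hA : IsBoundedCoercive Ω A) :
    IsBoundedCoercive Ω (symmetrized A) := by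
  obtain ⟨α, hα, h⟩ := hA.coercive
  exact ⟨fun i j => ((hA.memLp_top i j).add (hA.memLp_top j i)).const_mul (1 / 2), α, hα,
    h.mono fun x hx ξ => by rw [inner_symmetrized]; exact hx ξ⟩

theorem dirichletForm_symmetrized_comm
    (A : EuclideanSpace ℝ (Fin N) → Matrix (Fin N) (Fin N) ℝ)
    (U V : EuclideanSpace ℝ (Fin N) → EuclideanSpace ℝ (Fin N)) :
    dirichletForm Ω (symmetrized A) U V = dirichletForm Ω (symmetrized A) V U := by
  refine integral_congr_ae (ae_of_all _ fun x => ?_)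
  simp only [inner_toEuclideanLin_eq_sum, symmetrized, Matrix.smul_apply, Matrix.add_apply,
    Matrix.transpose_apply, smul_eq_mul]
  rw [Finset.sum_comm]
  exact Finset.sum_congr rfl fun i _ => Finset.sum_congr rfl fun j _ => by ring

/-- Every Rayleigh quotient of `A` on `H¹₀(Ω)` is bounded below by an eigenvalue of
`-div ˢA(x) D`. -/
theorem exists_isDirichletEigenvalue_le
    (hΩ : Bornology.IsBounded (Ω : Set (EuclideanSpace ℝ (Fin N))))
    {A : EuclideanSpace ℝ (Fin N) → Matrix (Fin N) (Fin N) ℝ} (hA : IsBoundedCoercive Ω A)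
    {w : EuclideanSpace ℝ (Fin N) → ℝ}
    {Dw : EuclideanSpace ℝ (Fin N) → EuclideanSpace ℝ (Fin N)} (hw : MemH10 Ω w Dw)
    (hw0 : ¬ w =ᵐ[domainMeasure Ω] 0) {c : ℝ}
    (hc : dirichletForm Ω A Dw Dw ≤ c * ∫ x, w x * w x ∂(domainMeasure Ω)) :
    ∃ μ ≤ c, IsDirichletEigenvalue Ω (symmetrized A) μ := by
  obtain ⟨hwL, hDwL, hmem⟩ := memH10_iff.1 hw
  have hS := hA.symmetrized
  have : CompleteSpace (h10 Ω) :=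
    (Submodule.isClosed_topologicalClosure (LinearMap.range (testPair Ω))).completeSpace_coe
  let π : h10 Ω →L[ℝ] Lp (EuclideanSpace ℝ (Fin N)) 2 (domainMeasure Ω) :=
    (ContinuousLinearMap.snd ℝ _ _).comp (h10 Ω).subtypeL
  let B : h10 Ω →L[ℝ] h10 Ω →L[ℝ] ℝ := hS.form.bilinearComp π π
  have hBapp : ∀ v v' : h10 Ω, B v v' = dirichletForm Ω (symmetrized A) v.1.2 v'.1.2 :=
    fun _ _ => rfl
  obtain ⟨α, hα, hcoer⟩ := hS.coercive
  have hB : ∀ v, α * ‖v‖ ^ 2 ≤ B v v + α * ‖h10Embedding Ω v‖ ^ 2 := fun v => by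
    have h1 : α * ‖v.1.2‖ ^ 2 ≤ B v v := by
      rw [← integral_norm_sq_eq_norm_sq, ← integral_const_mul, hBapp]
      refine integral_mono_ae ((Lp.memLp v.1.2).norm.integrable_sq.const_mul α)
        (hS.integrable_inner (Lp.memLp _) (Lp.memLp _)) ?_
      filter_upwards [hcoer] with x hx using hx _
    -- `h10 Ω` carries the sup norm of a product, not a Hilbert norm, which is why the abstract
    -- minimization asks only for a Banach space.
    have h2 : ‖v‖ ^ 2 ≤ ‖v.1.2‖ ^ 2 + ‖v.1.1‖ ^ 2 := by
      have : ‖v‖ = max ‖v.1.1‖ ‖v.1.2‖ := rfl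
      rcases max_cases ‖v.1.1‖ ‖v.1.2‖ with h | h <;> rw [this, h.1] <;> nlinarith [
        sq_nonneg ‖v.1.1‖, sq_nonneg ‖v.1.2‖]
    have h3 := mul_le_mul_of_nonneg_left h2 hα.le
    have h4 : ‖h10Embedding Ω v‖ = ‖v.1.1‖ := rfl
    rw [h4]
    linarith
  let v₀ : h10 Ω := ⟨_, hmem⟩
  have hv₀ : h10Embedding Ω v₀ ≠ 0 := fun h => hw0 <| by
    have h' : hwL.toLp w = 0 := h
    exact (MemLp.toLp_eq_toLp_iff hwL (MemLp.zero (p := 2))).1 (h'.trans (MemLp.toLp_zero _).symm)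
  have hBv₀ : B v₀ v₀ ≤ c * ‖h10Embedding Ω v₀‖ ^ 2 := by
    have e1 : B v₀ v₀ = dirichletForm Ω A Dw Dw := by
      rw [hBapp, dirichletForm_congr_ae hDwL.coeFn_toLp hDwL.coeFn_toLp]
      exact integral_congr_ae (ae_of_all _ fun x => inner_symmetrized A x (Dw x))
    have e2 : ‖h10Embedding Ω v₀‖ ^ 2 = ∫ x, w x * w x ∂(domainMeasure Ω) := by
      rw [← integral_norm_sq_eq_norm_sq]
      refine integral_congr_ae (hwL.coeFn_toLp.mono fun x hx => ?_)
      change ‖hwL.toLp w x‖ ^ 2 = _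
      rw [hx, Real.norm_eq_abs, sq_abs, sq]
    rw [e1, e2]
    exact hc
  obtain ⟨μ, hμ, u, hu0, hu⟩ := exists_eigenvector_le_rayleigh B
    (fun v v' => by rw [hBapp, hBapp, dirichletForm_symmetrized_comm]) (h10Embedding Ω)
    (isCompactOperator_h10Embedding hΩ) hα hB hv₀ hBv₀
  refine ⟨μ, hμ, u.1.1, u.1.2, ?_, ?_, ?_⟩
  · refine memH10_iff.2 ⟨Lp.memLp _, Lp.memLp _, ?_⟩
    rw [Lp.toLp_coeFn, Lp.toLp_coeFn]
    exact u.2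
  · intro h
    exact hu0 ((Lp.eq_zero_iff_ae_eq_zero).2 h)
  · intro φ Dφ hφ
    obtain ⟨hφL, hDφL, hφm⟩ := memH10_iff.1 hφ
    have h := hu ⟨_, hφm⟩
    rw [hBapp, dirichletForm_congr_ae EventuallyEq.rfl hDφL.coeFn_toLp] at h
    rw [h, L2.inner_def]
    congr 1
    refine integral_congr_ae (hφL.coeFn_toLp.mono fun x hx => ?_)
    change inner ℝ (u.1.1 x) (hφL.toLp φ x) = _
    rw [hx]
    exact mul_comm _ _

/-! ### The comparison argument. -/

/-- Moves the almost monotonicity condition from `EReal` to `ℝ≥0∞`, where it can be integrated.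
Infinite values are harmless: `b = ∞` is trivial, and `a = ∞` forces `b = ∞`. -/
theorem ENNReal.le_add_ofReal_of_coe_sub_le {a b : ℝ≥0∞} {r s : ℝ}
    (h : (a : EReal) - (r : EReal) ≤ (b : EReal) - (s : EReal)) :
    a ≤ b + ENNReal.ofReal (r - s) := by
  rcases eq_or_ne b ∞ with rfl | hb
  · simp
  lift b to NNReal using hb
  rcases eq_or_ne a ∞ with rfl | ha
  · rw [EReal.coe_ennreal_top, EReal.top_sub_coe, top_le_iff] at h
    exact absurd h (EReal.coe_ne_top ((b : ℝ) - s))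
  lift a to NNReal using ha
  rw [EReal.coe_nnreal_eq_coe_real, EReal.coe_nnreal_eq_coe_real] at h
  have h' : (a : ℝ) - r ≤ b - s := by exact_mod_cast h
  rw [← ENNReal.ofReal_coe_nnreal (p := a), ← ENNReal.ofReal_coe_nnreal (p := b)]
  refine (ENNReal.ofReal_le_ofReal ?_).trans ENNReal.ofReal_add_le
  linarith

/-- If `∫_Ω A Dw · Dw ≤ lam ∫_Ω w²` with `lam < λ₁` then `w = 0`. -/
theorem ae_eq_zero_of_dirichletForm_le
    (hΩ : Bornology.IsBounded (Ω : Set (EuclideanSpace ℝ (Fin N))))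
    {A : EuclideanSpace ℝ (Fin N) → Matrix (Fin N) (Fin N) ℝ} (hA : IsBoundedCoercive Ω A)
    {w : EuclideanSpace ℝ (Fin N) → ℝ}
    {Dw : EuclideanSpace ℝ (Fin N) → EuclideanSpace ℝ (Fin N)} (hw : MemH10 Ω w Dw)
    {lam : ℝ} (hlam : (lam : EReal) < firstEigenvalue Ω A)
    (h : dirichletForm Ω A Dw Dw ≤ lam * ∫ x, w x * w x ∂(domainMeasure Ω)) :
    w =ᵐ[domainMeasure Ω] 0 := by
  by_contra hw0
  obtain ⟨μ, hμ, hev⟩ := exists_isDirichletEigenvalue_le hΩ hA hw hw0 h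
  exact (hlam.trans_le (sInf_le ⟨μ, hev, rfl⟩)).not_ge (EReal.coe_le_coe_iff.2 hμ)

/-- Comparison under a one-sided Lipschitz bound between the two right-hand sides. -/
theorem ae_le_of_forall_le_add_ofReal
    (hΩ : Bornology.IsBounded (Ω : Set (EuclideanSpace ℝ (Fin N))))
    {A : EuclideanSpace ℝ (Fin N) → Matrix (Fin N) (Fin N) ℝ} (hA : IsBoundedCoercive Ω A)
    {F₁ F₂ : EuclideanSpace ℝ (Fin N) → ℝ → ℝ≥0∞} {u₁ u₂ : EuclideanSpace ℝ (Fin N) → ℝ}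
    (hu₁ : IsSolution Ω A F₁ u₁) (hu₂ : IsSolution Ω A F₂ u₂) {lam : ℝ} (hlam0 : 0 ≤ lam)
    (hlam : (lam : EReal) < firstEigenvalue Ω A)
    (hF : ∀ᵐ x ∂(domainMeasure Ω), ∀ s t : ℝ, 0 ≤ t → t ≤ s →
      F₁ x s ≤ F₂ x t + ENNReal.ofReal (lam * s - lam * t)) :
    ∀ᵐ x ∂(domainMeasure Ω), u₁ x ≤ u₂ x := by
  obtain ⟨Du₁, hH₁, -, hsol₁⟩ := hu₁
  obtain ⟨Du₂, hH₂, hpos₂, hsol₂⟩ := hu₂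
  have hw := (hH₁.sub hH₂).posPart
  set w : EuclideanSpace ℝ (Fin N) → ℝ := fun x => max ((u₁ - u₂) x) 0 with hwdef
  set Dw := {x | 0 < (u₁ - u₂) x}.indicator (Du₁ - Du₂) with hDw
  have hw0 : ∀ x, 0 ≤ w x := fun x => le_max_right _ _
  obtain ⟨hfin₁, he₁⟩ := hsol₁ w Dw hw (ae_of_all _ hw0)
  obtain ⟨hfin₂, he₂⟩ := hsol₂ w Dw hw (ae_of_all _ hw0)
  have hww : Integrable (fun x => w x * w x) (domainMeasure Ω) := hw.memLp.integrable_mul hw.memLp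
  -- `Dw` coincides with `Du₁ - Du₂` wherever it is paired with a nonzero vector, by the choice of
  -- `Dw` as an indicator.
  have hform : dirichletForm Ω A Dw Dw = dirichletForm Ω A Du₁ Dw - dirichletForm Ω A Du₂ Dw := by
    rw [dirichletForm, dirichletForm, dirichletForm,
      ← integral_sub (hA.integrable_inner hH₁.memLp_grad hw.memLp_grad)
        (hA.integrable_inner hH₂.memLp_grad hw.memLp_grad)]
    refine integral_congr_ae (ae_of_all _ fun x => ?_)
    simp only [← inner_sub_left, ← map_sub, hDw]
    by_cases hx : x ∈ {x | 0 < (u₁ - u₂) x}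
    · rw [Set.indicator_of_mem hx, Pi.sub_apply]
    · rw [Set.indicator_of_notMem hx, inner_zero_right, inner_zero_right]
  have hle : ∫⁻ x, F₁ x (u₁ x) * ENNReal.ofReal (w x) ∂(domainMeasure Ω) ≤
      ∫⁻ x, F₂ x (u₂ x) * ENNReal.ofReal (w x) ∂(domainMeasure Ω) +
        ∫⁻ x, ENNReal.ofReal (lam * (w x * w x)) ∂(domainMeasure Ω) := by
    rw [← lintegral_add_right' _ (hww.const_mul lam).1.aemeasurable.ennreal_ofReal]
    refine lintegral_mono_ae ?_
    filter_upwards [hF, hpos₂] with x hx hx2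
    rcases le_or_gt (u₁ x) (u₂ x) with hux | hux
    · have : w x = 0 := by simp [hwdef, hux]
      simp [this]
    · have hwx : w x = u₁ x - u₂ x := by simp [hwdef, hux.le]
      have hx' := hx (u₁ x) (u₂ x) hx2 hux.le
      rw [← mul_sub, ← hwx] at hx'
      refine (mul_le_mul_left hx' _).trans ?_
      rw [add_mul, ← ENNReal.ofReal_mul (mul_nonneg hlam0 (hw0 x)), mul_assoc lam]
  have hlw : ∫⁻ x, ENNReal.ofReal (lam * (w x * w x)) ∂(domainMeasure Ω) =
      ENNReal.ofReal (lam * ∫ x, w x * w x ∂(domainMeasure Ω)) := by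
    rw [← integral_const_mul, ofReal_integral_eq_lintegral_ofReal (hww.const_mul lam)
      (ae_of_all _ fun x => mul_nonneg hlam0 (mul_self_nonneg _))]
  have hR : 0 ≤ lam * ∫ x, w x * w x ∂(domainMeasure Ω) :=
    mul_nonneg hlam0 (integral_nonneg fun x => mul_self_nonneg _)
  rw [hlw] at hle
  -- Finiteness of the second source term is what allows passing to real numbers and subtracting the
  -- two equations.
  have hreal := ENNReal.toReal_mono (ENNReal.add_ne_top.2 ⟨hfin₂.ne, ENNReal.ofReal_ne_top⟩) hle
  rw [ENNReal.toReal_add hfin₂.ne ENNReal.ofReal_ne_top, ENNReal.toReal_ofReal hR, ← he₁,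
    ← he₂] at hreal
  have hzero := ae_eq_zero_of_dirichletForm_le hΩ hA hw hlam (by rw [hform]; linarith)
  filter_upwards [hzero] with x hx
  have h : max ((u₁ - u₂) x) 0 = 0 := hx
  exact sub_nonpos.1 (max_eq_right_iff.1 h)

end

theorem theorem8p1 {N : ℕ} (hN : 1 ≤ N)
    (Ω : Opens (EuclideanSpace ℝ (Fin N)))
    (hΩ : Bornology.IsBounded (Ω : Set (EuclideanSpace ℝ (Fin N))))
    (A : EuclideanSpace ℝ (Fin N) → Matrix (Fin N) (Fin N) ℝ)
    (hA : IsBoundedCoercive Ω A)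
    (F₁ F₂ : EuclideanSpace ℝ (Fin N) → ℝ → ℝ≥0∞)
    (hF₁ : IsCaratheodory Ω F₁) (hF₁' : HasMildSingularity Ω F₁)
    (hF₂ : IsCaratheodory Ω F₂) (hF₂' : HasMildSingularity Ω F₂)
    (hmono : IsAlmostNonincreasing Ω A F₁ ∨ IsAlmostNonincreasing Ω A F₂)
    (hle : ∀ᵐ x ∂(volume.restrict (Ω : Set (EuclideanSpace ℝ (Fin N)))),
      ∀ s : ℝ, 0 ≤ s → F₁ x s ≤ F₂ x s)
    (u₁ u₂ : EuclideanSpace ℝ (Fin N) → ℝ)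
    (hu₁ : IsSolution Ω A F₁ u₁) (hu₂ : IsSolution Ω A F₂ u₂) :
    ∀ᵐ x ∂(volume.restrict (Ω : Set (EuclideanSpace ℝ (Fin N)))), u₁ x ≤ u₂ x := by
  rcases hmono with ⟨lam, h0, hlam, h⟩ | ⟨lam, h0, hlam, h⟩
  · refine ae_le_of_forall_le_add_ofReal hΩ hA hu₁ hu₂ h0 hlam ?_
    filter_upwards [h, hle] with x hx hx' s t ht hts
    exact (ENNReal.le_add_ofReal_of_coe_sub_le (hx s t ht hts)).trans
      (add_le_add_left (hx' t ht) _)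
  · refine ae_le_of_forall_le_add_ofReal hΩ hA hu₁ hu₂ h0 hlam ?_
    filter_upwards [h, hle] with x hx hx' s t ht hts
    exact (hx' s (ht.trans hts)).trans (ENNReal.le_add_ofReal_of_coe_sub_le (hx s t ht hts))
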